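/- Call $L$-function any element of the extended Selberg class $\mathcal S^{\sharp}$, that is, a Dirichlet series $L(s)=\sum_{n\ge 1}a(n)n^{-s}$ with $a(1)=1$ such that: (i) $a(n)\ll n^{\varepsilon}$ for every $\varepsilon>0$; (ii) there is an integer $k\ge 0$ such that $(s-1)^kL(s)$ extends to an entire function of finite order; (iii) $L$ satisfies a functional equation $\Lambda_L(s)=\omega\,\overline{\Lambda_L(1-\overline{s})}$, where $\Lambda_L(s)=L(s)Q^s\prod_{j=1}^{K}\Gamma(\lambda_js+\mu_j)$ with $K\ge 0$, $Q>0$, $\lambda_j>0$, $\operatorname{Re}\mu_j\ge 0$ and $|\omega|=1$. The degree of $L$ is $d_L=2\sum_{j=1}^{K}\lambda_j$. For a meromorphic function $f$ on $\mathbb C$ let $T(r,f)$ be its Nevanlinna characteristic and $\rho(f)=\limsup_{r\to\infty}\frac{\log^{+}T(r,f)}{\log r}\in[0,\infty]$ its order. Theorem. Let $h$ be a transcendental (that is, non-rational) meromorphic function on $\mathbb C$ with at least one pole, such that $\rho(h)$ is finite and is not a positive integer. Let $L_1,L_2$ be two $L$-functions with positive degree; they need not satisfy the same functional equation. If $L_1-h$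 and $L_2-h$ have the same zeros counting multiplicities, then $L_1\equiv L_2$. -/

import Mathlib

open Filter Polynomial
open scoped ComplexConjugate

namespace MovingTarget

/-- The Gamma-completed function
`Λ(s) = L(s) * Q ^ s * ∏ j, Γ(lam j * s + mu j)` attached to `L` and the data `Q, lam, mu`. -/
noncomputable def completed (L : ℂ → ℂ) {K : ℕ} (Q : ℝ) (lam : Fin K → ℝ) (mu : Fin K → ℂ)
    (s : ℂ) : ℂ :=
  L s * (Q : ℂ) ^ s * ∏ j, Complex.Gamma ((lam j : ℂ) * s + mu j)

/-- `L` satisfies the functional equation `Λ(s) = ω * conj (Λ(1 - conj s))` with data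
`Q > 0`, `lam j > 0`, `Re (mu j) ≥ 0`, `|ω| = 1`. This is an identity of meromorphic functions, so
it is required off a closed discrete set (which contains the poles, where the values of the two
sides carry no meaning). -/
structure SatisfiesFE (L : ℂ → ℂ) {K : ℕ} (Q : ℝ) (lam : Fin K → ℝ) (mu : Fin K → ℂ) (ω : ℂ) :
    Prop where
  Q_pos : 0 < Q
  lam_pos : ∀ j, 0 < lam j
  mu_re_nonneg : ∀ j, 0 ≤ (mu j).re
  norm_omega : ‖ω‖ = 1
  functional_equation : ∀ᶠ s in codiscrete ℂ,
    completed L Q lam mu s = ω * conj (completed L Q lam mu (1 - conj s))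

/-- `L` has degree `d`: it satisfies a functional equation whose data give `d = 2 * ∑ j, lam j`. -/
def HasDegree (L : ℂ → ℂ) (d : ℝ) : Prop :=
  ∃ (K : ℕ) (Q : ℝ) (lam : Fin K → ℝ) (mu : Fin K → ℂ) (ω : ℂ),
    SatisfiesFE L Q lam mu ω ∧ d = 2 * ∑ j, lam j

/-- An entire function of finite order. -/
def IsEntireOfFiniteOrder (F : ℂ → ℂ) : Prop :=
  Differentiable ℂ F ∧
    ∃ A : ℝ, F =O[Bornology.cobounded ℂ] fun s => Real.exp (‖s‖ ^ A)

/-- `L` is (the meromorphic continuation to `ℂ` of) an element of the extended Selberg class.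
The value `L 1` is left arbitrary, since `L` may have a pole there. -/
def IsLFunction (L : ℂ → ℂ) : Prop :=
  (∃ a : ℕ → ℂ, a 1 = 1 ∧
    (∀ ε : ℝ, 0 < ε → a =O[atTop] fun n : ℕ => (n : ℝ) ^ ε) ∧
    (∀ s : ℂ, 1 < s.re → L s = LSeries a s)) ∧
  (∃ (k : ℕ) (F : ℂ → ℂ), IsEntireOfFiniteOrder F ∧ ∀ s : ℂ, s ≠ 1 → (s - 1) ^ k * L s = F s) ∧
  (∃ (K : ℕ) (Q : ℝ) (lam : Fin K → ℝ) (mu : Fin K → ℂ) (ω : ℂ), SatisfiesFE L Q lam mu ω)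

/-- A meromorphic function on `ℂ` that is not a rational function. -/
def IsTranscendentalMeromorphic (h : ℂ → ℂ) : Prop :=
  Meromorphic h ∧
    ¬ ∃ p q : ℂ[X], q ≠ 0 ∧ h =ᶠ[codiscrete ℂ] fun z => p.eval z / q.eval z

/-- The order `ρ(f) = limsup_{r → ∞} log⁺ T(r, f) / log r`, where `T(r, f)` is the Nevanlinna
characteristic of `f`; it is an extended real number. -/
noncomputable def nevanlinnaOrder (f : ℂ → ℂ) : EReal :=
  limsup (fun r : ℝ =>
    ((Real.posLog (ValueDistribution.characteristic f ⊤ r) / Real.log r : ℝ) : EReal)) atTop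

/-- `f` and `g` have the same zeros counting multiplicities: at every point, the multiplicity of
the zero of `f` (which is `0` if `f` has no zero there) is that of `g`. -/
def SameZerosCM (f g : ℂ → ℂ) : Prop :=
  ∀ z : ℂ, max (meromorphicOrderAt f z) 0 = max (meromorphicOrderAt g z) 0

end MovingTarget

/-! Suppose `L₁` and `L₂` differ, and put `G = (L₁ - h) / (L₂ - h)`. Off the point `1` both
`L`-functions are holomorphic, so a pole of `h` is a pole of numerator and denominator of the same
order, and the remaining zeros are shared. Hence `G` has neither zeros nor poles except possibly at
`1` (`SameZerosCM.meromorphicOrderAt_eq`).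

The Dirichlet series on the right, the functional equation with Gamma bounds on the left, and
Phragmén–Lindelöf in between show that each `L`-function has characteristic `O(r ^ q)` for every `q
> 1` (`IsLFunction.exists_growth`). So `T(r, G) = O(r ^ A)` for every `A` exceeding both `1` and the
order of `h`. A Hadamard-type argument then gives `G = (z - 1) ^ m * exp p` with `p` a polynomial of
degree at most `A` (`exists_eq_zpow_mul_exp_of_isBigO`). Since `G` is not identically `1`, solving
for `h` gives `h = L₂ + (L₁ - L₂) / (1 - G)`. Two consequences of this formula are contradictory.

Lower bound: `L₁` and `L₂` tend to `1` like `2 ^ (-Re s)` to the right, and `1 - G` stays away from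
`0` on some arc of directions in the right half-plane. So `h - 1` decays exponentially there, and
the first main theorem makes `T(r, h)` grow at least linearly
(`exists_mul_le_characteristic_of_eq`). Orders below `1` are thus impossible.

Upper bound: an order `x ≥ 1` that is not an integer lies strictly between `⌊x⌋` and `⌊x⌋ + 1`.
Taking `A` below `⌊x⌋ + 1` forces `deg p ≤ ⌊x⌋`. The formula then bounds `T(r, h)` by a power of `r`
with exponent strictly between `⌊x⌋` and `x`, so the order of `h` is less than `x`. -/

namespace MovingTarget

/-! ### Entire functions with controlled real part -/

open Complex Metric Real in
/-- The Taylor coefficients of an entire function as circle averages. -/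
theorem circleAverage_zpow_mul_of_differentiable {g : ℂ → ℂ} (hg : Differentiable ℂ g) (n : ℕ)
    {r : ℝ} (hr : 0 < r) :
    Real.circleAverage (fun z ↦ (z⁻¹) ^ n * g z) 0 r = (n.factorial : ℂ)⁻¹ * iteratedDeriv n g 0 := by
  have h1 := DiffContOnCl.circleIntegral_one_div_sub_center_pow_smul (c := (0 : ℂ)) hr n
    (hg.diffContOnCl (s := ball 0 r))
  rw [circleAverage_eq_circleIntegral hr.ne']
  have h2 : (∮ z in C(0, r), (z - 0)⁻¹ • ((z⁻¹) ^ n * g z)) =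
      ∮ z in C(0, r), (1 / (z - 0) ^ (n + 1)) • g z := by
    congr 1
    ext z
    simp only [sub_zero, smul_eq_mul, one_div, pow_succ, mul_inv, inv_pow]
    ring
  rw [h2, h1]
  have : (2 * π * I : ℂ) ≠ 0 := by simp [Real.pi_ne_zero]
  simp only [smul_eq_mul]
  field_simp

open Complex Metric Real in
/-- The Taylor coefficients of positive degree are controlled by the mean of the absolute value of
the real part. -/
theorem norm_taylorCoeff_mul_pow_le {g : ℂ → ℂ} (hg : Differentiable ℂ g) {n : ℕ} (hn : n ≠ 0)
    {r : ℝ} (hr : 0 < r) :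
    ‖(n.factorial : ℂ)⁻¹ * iteratedDeriv n g 0‖ * r ^ n ≤
      2 * Real.circleAverage (fun z ↦ |(g z).re|) 0 r := by
  set c := (n.factorial : ℂ)⁻¹ * iteratedDeriv n g 0
  have cont : ∀ {f : ℂ → ℂ}, ContinuousOn f (sphere 0 r) → CircleIntegrable f 0 r :=
    fun hf ↦ hf.circleIntegrable hr.le
  have hinv : ContinuousOn (fun z : ℂ ↦ (z⁻¹) ^ n) (sphere 0 r) := by
    refine ContinuousOn.pow (continuousOn_inv₀.mono fun z hz ↦ ?_) n
    rintro rfl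
    simp [hr.ne] at hz
  -- The mean value property gives this, since `z ^ n * g z` vanishes at `0`. On the circle `conj z
  -- = r ^ 2 / z`, so conjugation shows that `z⁻¹ ^ n * conj (g z)` also has mean zero. In the
  -- coefficient formula `g` may therefore be replaced by `g + conj g = 2 Re g`.
  have h0 : Real.circleAverage (fun z ↦ z ^ n * g z) 0 r = 0 := by
    have := (((differentiable_id.pow n).mul hg).diffContOnCl (s := ball 0 |r|)).circleAverage
    simpa [hn, Pi.mul_def, Pi.pow_def] using this
  have h0' : Real.circleAverage (fun z ↦ (z⁻¹) ^ n * conj (g z)) 0 r = 0 := by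
    have h1 : Real.circleAverage (fun z ↦ conj (z ^ n * g z)) 0 r = 0 := by
      have := (Complex.conjCLE : ℂ →L[ℝ] ℂ).circleAverage_comp_comm (c := 0) (R := r)
        (f := fun z ↦ z ^ n * g z) (cont (by have := hg.continuous; fun_prop))
      rw [h0] at this
      simpa [Function.comp_def] using this
    have h2 : Real.circleAverage (fun z ↦ (z⁻¹) ^ n * conj (g z)) 0 r =
        Real.circleAverage (fun z ↦ (((r : ℂ) ^ 2) ^ n)⁻¹ • conj (z ^ n * g z)) 0 r := by
      refine Real.circleAverage_congr_sphere fun z hz ↦ ?_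
      have hz' : ‖z‖ = r := by simpa [abs_of_pos hr] using hz
      have hz0 : z ≠ 0 := by rintro rfl; simp at hz'; exact hr.ne hz'
      have hc : conj z = (r : ℂ) ^ 2 * z⁻¹ := by
        rw [eq_mul_inv_iff_mul_eq₀ hz0, mul_comm, Complex.mul_conj, Complex.normSq_eq_norm_sq, hz']
        push_cast; rfl
      have hr0 : (r : ℂ) ≠ 0 := by exact_mod_cast hr.ne'
      simp only [map_mul, map_pow, hc, smul_eq_mul, mul_pow]
      field_simp
    rw [h2, Real.circleAverage_fun_smul, h1, smul_zero]
  have hsum : c = Real.circleAverage (fun z ↦ (z⁻¹) ^ n * (2 * (g z).re : ℝ)) 0 r := by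
    have h3 := Real.circleAverage_add (c := 0) (R := r) (f₁ := fun z ↦ (z⁻¹) ^ n * g z)
      (f₂ := fun z ↦ (z⁻¹) ^ n * conj (g z)) (cont (hinv.mul hg.continuous.continuousOn))
      (cont (hinv.mul (Complex.continuous_conj.comp hg.continuous).continuousOn))
    rw [h0', add_zero, circleAverage_zpow_mul_of_differentiable hg n hr] at h3
    refine h3.symm.trans ?_
    congr 1
    ext z
    simp only [Pi.add_apply, ← mul_add, Complex.add_conj]
  have hle : ‖c‖ ≤ Real.circleAverage (fun z ↦ 2 * (r ^ n)⁻¹ * |(g z).re|) 0 r := by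
    rw [hsum, Real.circleAverage_def, Real.circleAverage_def, norm_smul, smul_eq_mul,
      Real.norm_of_nonneg (by positivity)]
    gcongr
    refine (intervalIntegral.norm_integral_le_integral_norm (by positivity)).trans (le_of_eq ?_)
    congr 1
    ext θ
    simp only [norm_mul, norm_pow, norm_inv, norm_circleMap_zero, abs_of_pos hr, norm_real,
      Real.norm_eq_abs, abs_two, inv_pow]
    ring
  have hs := Real.circleAverage_fun_smul (a := 2 * (r ^ n)⁻¹) (f := fun z ↦ |(g z).re|)
    (c := 0) (R := r)
  simp only [smul_eq_mul] at hs
  rw [hs] at hle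
  have hrn : 0 < r ^ n := by positivity
  calc ‖c‖ * r ^ n ≤ 2 * (r ^ n)⁻¹ * Real.circleAverage (fun z ↦ |(g z).re|) 0 r * r ^ n := by gcongr
    _ = _ := by field_simp

open Complex Metric Real in
/-- An entire function whose real part has polynomially bounded circle means is a polynomial. -/
theorem exists_polynomial_of_circleAverage_abs_re_le {g : ℂ → ℂ} (hg : Differentiable ℂ g)
    {A C : ℝ} (hA : 0 ≤ A)
    (hC : ∀ᶠ r : ℝ in atTop, Real.circleAverage (fun z ↦ |(g z).re|) 0 r ≤ C * r ^ A) :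
    ∃ p : ℂ[X], (p.natDegree : ℝ) ≤ A ∧ ∀ z, g z = p.eval z := by
  have key : ∀ n : ℕ, A < n → (n.factorial : ℂ)⁻¹ * iteratedDeriv n g 0 = 0 := by
    intro n hn
    have hn0 : n ≠ 0 := by rintro rfl; norm_num at hn; linarith
    set c := (n.factorial : ℂ)⁻¹ * iteratedDeriv n g 0
    have hlim : Tendsto (fun r : ℝ ↦ 2 * C * r ^ (-((n : ℝ) - A))) atTop (nhds 0) := by
      simpa using (tendsto_rpow_neg_atTop (sub_pos.2 hn)).const_mul (2 * C)
    have hle : ‖c‖ ≤ 0 := by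
      refine ge_of_tendsto hlim ?_
      filter_upwards [hC, eventually_gt_atTop 0] with r hr hr0
      have h1 := (norm_taylorCoeff_mul_pow_le hg hn0 hr0).trans
        (mul_le_mul_of_nonneg_left hr zero_le_two)
      rw [neg_sub, Real.rpow_sub hr0, Real.rpow_natCast]
      have : 0 < r ^ n := by positivity
      calc ‖c‖ = ‖c‖ * r ^ n / r ^ n := by field_simp
        _ ≤ 2 * (C * r ^ A) / r ^ n := by gcongr
        _ = _ := by ring
    simpa using hle
  set N := ⌊A⌋₊
  refine ⟨∑ n ∈ Finset.range (N + 1),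
    Polynomial.monomial n ((n.factorial : ℂ)⁻¹ * iteratedDeriv n g 0), ?_, fun z ↦ ?_⟩
  · refine le_trans ?_ (Nat.floor_le hA)
    exact_mod_cast Polynomial.natDegree_sum_le_of_forall_le _ _ fun n hn ↦
      (Polynomial.natDegree_monomial_le _).trans (by simpa [Nat.lt_succ_iff] using hn)
  · rw [← Complex.taylorSeries_eq_of_entire' 0 z hg, tsum_eq_sum (s := Finset.range (N + 1))]
    · simp [Polynomial.eval_finsetSum, Polynomial.eval_monomial]
    · intro n hn
      have : N < n := by simpa using hn
      rw [key n ((Nat.floor_lt hA).1 this), zero_mul]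

/-- A zero-free entire function is an exponential. -/
theorem exists_eq_exp_of_differentiable {f : ℂ → ℂ} (hf : Differentiable ℂ f) (h0 : ∀ z, f z ≠ 0) :
    ∃ g : ℂ → ℂ, Differentiable ℂ g ∧ ∀ z, f z = Complex.exp (g z) := by
  -- The logarithmic derivative is entire, so it has a primitive `g`, normalised by `g 0 = log (f
  -- 0)`; then `f * exp (-g)` is the constant `1`.
  have hd : Differentiable ℂ (fun z ↦ deriv f z / f z) :=
    (hf.deriv).div hf h0
  obtain ⟨g, hg0, hg⟩ := hd.isExactOn_univ.with_val_at 0 (Complex.log (f 0))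
  have hg' : ∀ z, HasDerivAt g (deriv f z / f z) z := fun z ↦ hg z trivial
  have hgd : Differentiable ℂ g := fun z ↦ (hg' z).differentiableAt
  refine ⟨g, hgd, fun z ↦ ?_⟩
  have hconst := is_const_of_deriv_eq_zero (f := fun z ↦ f z * Complex.exp (-g z))
    (hf.mul (hgd.neg.cexp)) (fun z ↦ by
      have h1 := (hf z).hasDerivAt.mul (hg' z).neg.cexp
      refine h1.deriv.trans ?_
      have := h0 z
      simp only [Pi.neg_apply]
      field_simp
      ring) z 0
  simp only [hg0, Complex.exp_neg, Complex.exp_log (h0 0), mul_inv_cancel₀ (h0 0)] at hconst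
  exact mul_inv_eq_one₀ (Complex.exp_ne_zero _) |>.1 hconst

/-! ### Growth of `L`-functions -/

/-- A Dirichlet series with leading coefficient `1` tends to `1` exponentially fast. -/
theorem norm_LSeries_sub_one_le {a : ℕ → ℂ} (ha1 : a 1 = 1)
    (ha : ∀ ε : ℝ, 0 < ε → a =O[atTop] fun n : ℕ => (n : ℝ) ^ ε) :
    ∃ C : ℝ, 0 ≤ C ∧ ∀ s : ℂ, 2 ≤ s.re → ‖LSeries a s - 1‖ ≤ C * 2 ^ (-s.re) := by
  have hsum : ∀ s : ℂ, 2 ≤ s.re → LSeriesSummable a s := fun s hs ↦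
    LSeriesSummable_of_isBigO_rpow (x := 3 / 2) (by linarith) (ha _ (by norm_num))
  have h2 : Summable fun n ↦ ‖LSeries.term a 2 n‖ := (hsum 2 (by simp)).norm
  -- Termwise comparison with the absolutely convergent series at `s = 2`: for `n ≥ 2` the extra
  -- factor `n ^ (-(Re s - 2))` is at most `2 ^ (-(Re s - 2)) = 4 * 2 ^ (-Re s)`.
  refine ⟨4 * ∑' n, ‖LSeries.term a 2 n‖, by positivity, fun s hs ↦ ?_⟩
  have hδ : HasSum (fun n : ℕ ↦ if n = 1 then (1 : ℂ) else 0) 1 := by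
    simpa using hasSum_ite_eq (1 : ℕ) (1 : ℂ)
  have hs' := (hsum s hs).LSeriesHasSum
  have h1 : HasSum (fun n ↦ LSeries.term a s n - if n = 1 then (1 : ℂ) else 0)
      (LSeries a s - 1) :=
    HasSum.sub (L := SummationFilter.unconditional ℕ) hs' hδ
  have h3 : HasSum (fun n ↦ 4 * 2 ^ (-s.re) * ‖LSeries.term a 2 n‖)
      (4 * 2 ^ (-s.re) * ∑' n, ‖LSeries.term a 2 n‖) := h2.hasSum.mul_left _
  rw [mul_right_comm, ← h1.tsum_eq]
  refine tsum_of_norm_bounded h3 fun n ↦ ?_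
  rcases eq_or_ne n 0 with rfl | hn0
  · simp
  rcases eq_or_ne n 1 with rfl | hn1
  · rw [if_pos rfl, LSeries.term_of_ne_zero one_ne_zero, ha1, Nat.cast_one, Complex.one_cpow,
      div_one, sub_self, norm_zero]
    positivity
  · rw [if_neg hn1, sub_zero, LSeries.norm_term_eq, LSeries.norm_term_eq, if_neg hn0, if_neg hn0]
    obtain ⟨x, hxn⟩ : ∃ x : ℝ, x = n := ⟨_, rfl⟩
    rw [← hxn]
    have hx : 2 ≤ x := by
      rw [hxn]; exact_mod_cast (by omega : 2 ≤ n)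
    have hx0 : 0 < x := by linarith
    have h4 : x ^ (-(s.re - 2)) ≤ 2 ^ (-(s.re - 2)) :=
      Real.rpow_le_rpow_of_nonpos (by norm_num) hx (by linarith)
    have h5 : (2 : ℝ) ^ (-(s.re - 2)) = 4 * 2 ^ (-s.re) := by
      rw [show -(s.re - 2) = 2 + -s.re by ring, Real.rpow_add (by norm_num)]
      norm_num
    have h6 : (x ^ s.re)⁻¹ = x ^ (-(s.re - 2)) * (x ^ (2 : ℝ))⁻¹ := by
      rw [← Real.rpow_neg hx0.le, ← Real.rpow_neg hx0.le, ← Real.rpow_add hx0]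
      congr 1; ring
    rw [div_eq_mul_inv, h6, Complex.re_ofNat, div_eq_mul_inv]
    rw [h5] at h4
    calc _ = x ^ (-(s.re - 2)) * (‖a n‖ * (x ^ (2 : ℝ))⁻¹) := by ring
      _ ≤ _ := by gcongr

/-! ### Bounds for the Gamma function and its reciprocal. -/

open MeasureTheory in
theorem norm_Gamma_le_Gamma_re {z : ℂ} (hz : 0 < z.re) : ‖Complex.Gamma z‖ ≤ Real.Gamma z.re := by
  rw [Complex.Gamma_eq_integral hz, Real.Gamma_eq_integral hz, Complex.GammaIntegral]
  refine (norm_integral_le_integral_norm _).trans (le_of_eq ?_)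
  refine setIntegral_congr_fun measurableSet_Ioi fun x (hx : 0 < x) ↦ ?_
  simp only [norm_mul]
  rw [Complex.norm_of_nonneg (Real.exp_pos _).le, Complex.norm_cpow_eq_rpow_re_of_pos hx]
  simp

theorem norm_sin_le_exp (z : ℂ) : ‖Complex.sin z‖ ≤ Real.exp |z.im| := by
  rw [Complex.sin, norm_div, norm_mul, Complex.norm_I, mul_one, Complex.norm_ofNat,
    div_le_iff₀ two_pos]
  refine (norm_sub_le _ _).trans ?_
  rw [Complex.norm_exp, Complex.norm_exp]
  simp only [Complex.mul_re, Complex.neg_re, Complex.I_re, Complex.I_im, Complex.neg_im]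
  linarith [Real.exp_le_exp.2 (le_abs_self z.im), Real.exp_le_exp.2 (neg_le_abs z.im),
    show -z.re * 0 - -z.im * 1 = z.im by ring, show z.re * 0 - z.im * 1 = -z.im by ring,
    congrArg Real.exp (show -z.re * 0 - -z.im * 1 = z.im by ring),
    congrArg Real.exp (show z.re * 0 - z.im * 1 = -z.im by ring)]

/-- A bound for the reciprocal of the Gamma function in a left half-plane. -/
theorem norm_inv_Gamma_le {w : ℂ} (hw : w.re < 1) :
    ‖(Complex.Gamma w)⁻¹‖ ≤ Real.Gamma (1 - w.re) * Real.exp (Real.pi * |w.im|) := by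
  have hG : 0 < Real.Gamma (1 - w.re) := Real.Gamma_pos_of_pos (by linarith)
  by_cases h0 : Complex.Gamma w = 0
  · simp only [h0, inv_zero, norm_zero]; positivity
  have hne : Complex.Gamma (1 - w) ≠ 0 := Complex.Gamma_ne_zero_of_re_pos (by simp; linarith)
  have hmul := Complex.Gamma_mul_Gamma_one_sub w
  have hsin : Complex.sin (Real.pi * w) ≠ 0 := by
    intro h
    rw [h, div_zero] at hmul
    exact (mul_ne_zero h0 hne) hmul
  have hpi : (Real.pi : ℂ) ≠ 0 := by exact_mod_cast Real.pi_ne_zero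
  -- The reflection formula moves the reciprocal to `1 - w`, where Euler's integral bounds Gamma;
  -- the sine contributes the factor `exp (π |Im w|)`.
  have hinv : (Complex.Gamma w)⁻¹ = Complex.Gamma (1 - w) * Complex.sin (Real.pi * w) / Real.pi := by
    rw [eq_div_iff hsin] at hmul
    rw [eq_div_iff hpi, inv_mul_eq_iff_eq_mul₀ h0, ← mul_assoc, hmul]
  rw [hinv, norm_div, norm_mul, Complex.norm_real, Real.norm_of_nonneg Real.pi_pos.le]
  have h1 := norm_Gamma_le_Gamma_re (z := 1 - w) (by simp; linarith)
  have h2 := norm_sin_le_exp (Real.pi * w)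
  rw [Complex.im_ofReal_mul, abs_mul, abs_of_pos Real.pi_pos] at h2
  rw [Complex.sub_re, Complex.one_re] at h1
  calc _ ≤ ‖Complex.Gamma (1 - w)‖ * ‖Complex.sin (Real.pi * w)‖ :=
        div_le_self (by positivity) (by linarith [Real.pi_gt_three])
    _ ≤ _ := by gcongr

/-- The Gamma function grows more slowly than `exp (C * x ^ q)` for every `q > 1`. -/
theorem exists_Gamma_le_exp_rpow {q : ℝ} (hq : 1 < q) :
    ∃ C : ℝ, 0 ≤ C ∧ ∀ x y : ℝ, 2 ≤ x → x ≤ y → Real.Gamma x ≤ Real.exp (C * y ^ q) := by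
  -- With `n = ⌈y⌉ ≤ 2 y`, one has `Γ(x) ≤ n! ≤ exp (n log n)`, and `log n ≤ n ^ (q - 1) / (q - 1)`.
  refine ⟨2 ^ q / (q - 1), div_nonneg (by positivity) (by linarith), fun x y hx hxy ↦ ?_⟩
  set n := ⌈y⌉₊
  have hn : y ≤ n := Nat.le_ceil y
  have hn2 : (n : ℝ) ≤ 2 * y := by linarith [Nat.ceil_lt_add_one (a := y) (by linarith)]
  have hn0 : (0 : ℝ) < n := by linarith
  have h1 : Real.Gamma x ≤ Real.Gamma (n + 1) :=
    Real.Gamma_strictMonoOn_Ici.monotoneOn hx (by simp; linarith) (by linarith)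
  rw [Real.Gamma_nat_eq_factorial] at h1
  have h2 : (n.factorial : ℝ) ≤ (n : ℝ) ^ n := by exact_mod_cast n.factorial_le_pow
  have h3 : (n : ℝ) ^ n = Real.exp (n * Real.log n) := by
    rw [mul_comm, ← Real.rpow_def_of_pos hn0, Real.rpow_natCast]
  refine (h1.trans h2).trans (h3.le.trans (Real.exp_le_exp.2 ?_))
  calc (n : ℝ) * Real.log n ≤ n * ((n : ℝ) ^ (q - 1) / (q - 1)) := by
        gcongr; exact Real.log_le_rpow_div hn0.le (by linarith)
    _ = (n : ℝ) ^ q / (q - 1) := by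
        rw [Real.rpow_sub_one hn0.ne']; field_simp
    _ ≤ (2 * y) ^ q / (q - 1) := by
        have : 0 < q - 1 := by linarith
        gcongr
    _ = _ := by rw [Real.mul_rpow (by norm_num) (by linarith)]; ring

/-- The quotient of Gamma factors in an asymmetric functional equation, in a left half-plane. -/
theorem exists_norm_Gamma_quotient_le {q : ℝ} (hq : 1 < q) {l : ℝ} (hl : 0 < l) (m : ℂ) :
    ∃ M C D : ℝ, 0 ≤ M ∧ 0 ≤ C ∧ 0 ≤ D ∧ ∀ s : ℂ, s.re ≤ -M →
      ‖Complex.Gamma (l * (1 - conj s) + m)‖ * ‖(Complex.Gamma (l * s + m))⁻¹‖ ≤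
        Real.exp (C * (1 + |s.re|) ^ q + D * (1 + |s.im|)) := by
  obtain ⟨C, hC, hG⟩ := exists_Gamma_le_exp_rpow hq
  have hB : 0 < l + ‖m‖ + 1 := by positivity
  -- This abscissa forces `Re (l * s + m) ≤ -2`, so that both real Gamma values to be bounded have
  -- arguments at least `2`. Each of them contributes `C * (l + ‖m‖ + 1) ^ q`, whence the factor
  -- `2`.
  refine ⟨(2 + ‖m‖) / l, 2 * (C * (l + ‖m‖ + 1) ^ q), Real.pi * (l + ‖m‖), by positivity,
    by positivity, by have := Real.pi_pos; positivity, fun s hs ↦ ?_⟩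
  have hls : l * s.re ≤ -(2 + ‖m‖) := by
    have := mul_le_mul_of_nonneg_left hs hl.le
    rwa [mul_neg, mul_div_cancel₀ _ hl.ne'] at this
  have hm := abs_le.1 (Complex.abs_re_le_norm m)
  have hs0 : s.re ≤ 0 := hs.trans (neg_nonpos.2 (by positivity))
  have habs : |s.re| = -s.re := abs_of_nonpos hs0
  have hls0 : 0 ≤ l * |s.re| := by positivity
  have hms0 : 0 ≤ ‖m‖ * |s.re| := by positivity
  have hlabs : l * |s.re| = -(l * s.re) := by rw [habs]; ring
  have e1 : ((l : ℂ) * (1 - conj s) + m).re = l - l * s.re + m.re := by simp; ring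
  have e2 : ((l : ℂ) * s + m).re = l * s.re + m.re := by simp
  have e3 : ((l : ℂ) * s + m).im = l * s.im + m.im := by simp
  have hnn : 0 ≤ |s.re| := abs_nonneg _
  have b1 : ‖Complex.Gamma (l * (1 - conj s) + m)‖ ≤
      Real.exp (C * ((l + ‖m‖ + 1) * (1 + |s.re|)) ^ q) := by
    refine (norm_Gamma_le_Gamma_re (by rw [e1]; linarith [norm_nonneg m])).trans
      (hG _ _ ?_ ?_) <;> rw [e1] <;> nlinarith
  have b2 : ‖(Complex.Gamma (l * s + m))⁻¹‖ ≤
      Real.exp (C * ((l + ‖m‖ + 1) * (1 + |s.re|)) ^ q) *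
        Real.exp (Real.pi * (l + ‖m‖) * (1 + |s.im|)) := by
    refine (norm_inv_Gamma_le (by rw [e2]; linarith)).trans ?_
    refine mul_le_mul ?_ (Real.exp_le_exp.2 ?_) (Real.exp_pos _).le (Real.exp_pos _).le
    · refine hG _ _ ?_ ?_ <;> rw [e2] <;> nlinarith
    · rw [e3, mul_assoc]
      refine mul_le_mul_of_nonneg_left ?_ Real.pi_pos.le
      refine (abs_add_le _ _).trans ?_
      rw [abs_mul, abs_of_pos hl]
      nlinarith [Complex.abs_im_le_norm m, abs_nonneg s.im, norm_nonneg m,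
        mul_nonneg (norm_nonneg m) (abs_nonneg s.im)]
  refine (mul_le_mul b1 b2 (norm_nonneg _) (Real.exp_pos _).le).trans (le_of_eq ?_)
  rw [← Real.exp_add, ← Real.exp_add, Real.mul_rpow hB.le (by positivity)]
  congr 1; ring

/-! ### The functional equation in a left half-plane. -/

open Topology

theorem eventually_nhdsNE_of_codiscrete {p : ℂ → Prop} (hp : ∀ᶠ z in codiscrete ℂ, p z) (x : ℂ) :
    ∀ᶠ z in 𝓝[≠] x, p z := by
  have := mem_codiscrete.1 hp x
  rw [disjoint_principal_right, compl_compl] at this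
  exact this

/-- The reciprocal is entire and equals `1` at `s = (1 - m) / l`, so its zeros are discrete. As
`Complex.Gamma` takes the value `0` at its poles, those are excluded too. -/
theorem eventually_codiscrete_Gamma_ne_zero {l : ℝ} (hl : 0 < l) (m : ℂ) :
    ∀ᶠ s in codiscrete ℂ, Complex.Gamma (l * s + m) ≠ 0 := by
  have hl' : (l : ℂ) ≠ 0 := by exact_mod_cast hl.ne'
  have hd : Differentiable ℂ fun s : ℂ ↦ (Complex.Gamma (l * s + m))⁻¹ :=
    Complex.differentiable_one_div_Gamma.comp ((differentiable_id.const_mul (l : ℂ)).add_const m)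
  have han : AnalyticOnNhd ℂ (fun s : ℂ ↦ (Complex.Gamma (l * s + m))⁻¹) Set.univ :=
    Complex.analyticOnNhd_univ_iff_differentiable.2 hd
  have := han.preimage_zero_mem_codiscrete (x := (1 - m) / l) (by
    simp [mul_div_cancel₀ _ hl'])
  filter_upwards [this] with s hs
  simpa using hs

/-- The functional equation bounds an `L`-function in a left half-plane. -/
theorem exists_norm_le_exp_of_satisfiesFE {L : ℂ → ℂ} {C₀ : ℝ} (hC₀ : 0 ≤ C₀)
    (hL : ∀ s : ℂ, 2 ≤ s.re → ‖L s - 1‖ ≤ C₀ * 2 ^ (-s.re))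
    (hcont : ∀ s : ℂ, s ≠ 1 → ContinuousAt L s) {K : ℕ} {Q : ℝ} {lam : Fin K → ℝ}
    {mu : Fin K → ℂ} {ω : ℂ} (hFE : SatisfiesFE L Q lam mu ω) {q : ℝ} (hq : 1 < q) :
    ∃ M C D : ℝ, 1 ≤ M ∧ 0 ≤ C ∧ 0 ≤ D ∧ ∀ s : ℂ, s.re ≤ -M →
      ‖L s‖ ≤ Real.exp (C * (1 + |s.re|) ^ q + D * (1 + |s.im|)) := by
  choose M C D hM hC hD hG using fun j ↦ exists_norm_Gamma_quotient_le hq (hFE.lam_pos j) (mu j)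
  have hMj : ∀ j, M j ≤ ∑ j, M j := fun j ↦
    Finset.single_le_sum (fun i _ ↦ hM i) (Finset.mem_univ j)
  have hMs : 0 ≤ ∑ j, M j := Finset.sum_nonneg fun i _ ↦ hM i
  set C' : ℝ := C₀ + 2 * |Real.log Q| + ∑ j, C j with hC'
  have hC'0 : 0 ≤ C' := by
    have := Finset.sum_nonneg fun i (_ : i ∈ Finset.univ) ↦ hC i
    positivity
  have main : ∀ᶠ s in codiscrete ℂ, s.re ≤ -(∑ j, M j + 1) →
      ‖L s‖ ≤ Real.exp (C' * (1 + |s.re|) ^ q + (∑ j, D j) * (1 + |s.im|)) := by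
    filter_upwards [hFE.functional_equation, eventually_all.2 fun j ↦
      eventually_codiscrete_Gamma_ne_zero (hFE.lam_pos j) (mu j)] with s hs hΓ hre
    have hn := congrArg norm hs
    have hQ0 : 0 < Q := hFE.Q_pos
    simp only [completed, norm_mul, hFE.norm_omega, one_mul, RCLike.norm_conj, norm_prod,
      Complex.norm_cpow_eq_rpow_re_of_pos hQ0, Complex.sub_re, Complex.one_re,
      Complex.conj_re] at hn
    have hP : ∏ j, ‖Complex.Gamma (lam j * s + mu j)‖ ≠ 0 :=
      Finset.prod_ne_zero_iff.2 fun j _ ↦ norm_ne_zero_iff.2 (hΓ j)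
    have hQs : Q ^ s.re ≠ 0 := (Real.rpow_pos_of_pos hQ0 _).ne'
    have heq : ‖L s‖ = ‖L (1 - conj s)‖ * (Q ^ (1 - s.re) / Q ^ s.re) *
        ∏ j, (‖Complex.Gamma (lam j * (1 - conj s) + mu j)‖ *
          ‖(Complex.Gamma (lam j * s + mu j))⁻¹‖) := by
      simp only [norm_inv, Finset.prod_mul_distrib, Finset.prod_inv_distrib]
      rw [← div_eq_mul_inv, mul_div_assoc', eq_div_iff hP, mul_div_assoc', div_mul_eq_mul_div,
        eq_div_iff hQs, ← hn]
      ring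
    have hx1 : 1 ≤ 1 + |s.re| := by linarith [abs_nonneg s.re]
    have hxq : 1 + |s.re| ≤ (1 + |s.re|) ^ q := by
      simpa using Real.rpow_le_rpow_of_exponent_le hx1 hq.le
    have b1 : ‖L (1 - conj s)‖ ≤ Real.exp (C₀ * (1 + |s.re|) ^ q) := by
      have h2 := hL (1 - conj s) (by simp; linarith)
      have h3 : (2 : ℝ) ^ (-(1 - conj s).re) ≤ 1 :=
        Real.rpow_le_one_of_one_le_of_nonpos (by norm_num) (by simp; linarith)
      have h4 : ‖L (1 - conj s)‖ ≤ C₀ + 1 := by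
        calc ‖L (1 - conj s)‖ = ‖(L (1 - conj s) - 1) + 1‖ := by ring_nf
          _ ≤ ‖L (1 - conj s) - 1‖ + 1 := (norm_add_le _ _).trans (by simp)
          _ ≤ C₀ * 1 + 1 := by gcongr; exact h2.trans (by gcongr)
          _ = _ := by ring
      refine h4.trans ((Real.add_one_le_exp C₀).trans (Real.exp_le_exp.2 ?_))
      exact le_mul_of_one_le_right hC₀ (hx1.trans hxq)
    have b2 : Q ^ (1 - s.re) / Q ^ s.re ≤ Real.exp (2 * |Real.log Q| * (1 + |s.re|) ^ q) := by
      rw [← Real.rpow_sub hQ0, Real.rpow_def_of_pos hQ0]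
      refine Real.exp_le_exp.2 ?_
      calc Real.log Q * (1 - s.re - s.re) ≤ |Real.log Q * (1 - s.re - s.re)| := le_abs_self _
        _ = |Real.log Q| * |1 - s.re - s.re| := abs_mul _ _
        _ ≤ |Real.log Q| * (2 * (1 + |s.re|) ^ q) := by
          gcongr
          refine le_trans (abs_le.2 ⟨?_, ?_⟩) (mul_le_mul_of_nonneg_left hxq zero_le_two) <;>
            linarith [le_abs_self s.re, neg_abs_le s.re]
        _ = _ := by ring
    have b3 : ∏ j, (‖Complex.Gamma (lam j * (1 - conj s) + mu j)‖ *
          ‖(Complex.Gamma (lam j * s + mu j))⁻¹‖) ≤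
        Real.exp ((∑ j, C j) * (1 + |s.re|) ^ q + (∑ j, D j) * (1 + |s.im|)) := by
      rw [Finset.sum_mul, Finset.sum_mul, ← Finset.sum_add_distrib, Real.exp_sum]
      refine Finset.prod_le_prod (fun j _ ↦ by positivity) fun j _ ↦ hG j s ?_
      linarith [hMj j]
    rw [heq]
    calc _ ≤ Real.exp (C₀ * (1 + |s.re|) ^ q) * Real.exp (2 * |Real.log Q| * (1 + |s.re|) ^ q) *
          Real.exp ((∑ j, C j) * (1 + |s.re|) ^ q + (∑ j, D j) * (1 + |s.im|)) := by
          gcongr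
      _ = _ := by rw [← Real.exp_add, ← Real.exp_add, hC']; congr 1; ring
  refine ⟨∑ j, M j + 2, C', ∑ j, D j, by linarith, hC'0,
    Finset.sum_nonneg fun i _ ↦ hD i, fun s hs ↦ ?_⟩
  have hne : s ≠ 1 := by rintro rfl; simp at hs; linarith
  -- The functional equation says nothing on a discrete set, so the bound is carried to every point
  -- by continuity of `L`. The abscissa is moved one unit further left so that a whole neighbourhood
  -- of `s` lies in the region already treated.
  have hnear : ∀ᶠ z in 𝓝[≠] s, ‖L z‖ ≤
      Real.exp (C' * (1 + |z.re|) ^ q + (∑ j, D j) * (1 + |z.im|)) := by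
    have h1 : ∀ᶠ z in 𝓝[≠] s, z.re ≤ -(∑ j, M j + 1) := by
      refine eventually_nhdsWithin_of_eventually_nhds ?_
      filter_upwards [(isOpen_lt Complex.continuous_re continuous_const).mem_nhds
        (show s.re < -(∑ j, M j + 1) by linarith)] with z hz using le_of_lt hz
    have h2 := eventually_nhdsNE_of_codiscrete main s
    filter_upwards [h1, h2] with z hz1 hz2 using hz2 hz1
  have hc1 : Tendsto (fun z ↦ ‖L z‖) (𝓝[≠] s) (𝓝 ‖L s‖) :=
    (hcont s hne).norm.tendsto.mono_left nhdsWithin_le_nhds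
  have hc2 : Continuous fun z : ℂ ↦
      Real.exp (C' * (1 + |z.re|) ^ q + (∑ j, D j) * (1 + |z.im|)) := by
    have : Continuous fun z : ℂ ↦ (1 + |z.re|) ^ q :=
      Continuous.rpow_const (by fun_prop) fun z ↦ Or.inr (by linarith)
    fun_prop
  exact le_of_tendsto_of_tendsto hc1 ((hc2.tendsto s).mono_left nhdsWithin_le_nhds) hnear

/-! ### Phragmén–Lindelöf in the strip, and order at most one. -/

theorem re_cos (z : ℂ) : (Complex.cos z).re = Real.cos z.re * Real.cosh z.im := by
  rw [Complex.cos_eq, ← Complex.ofReal_cos, ← Complex.ofReal_cosh, ← Complex.ofReal_sin,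
    ← Complex.ofReal_sinh, Complex.sub_re, ← Complex.ofReal_mul, ← Complex.ofReal_mul,
    Complex.ofReal_re, Complex.re_ofReal_mul, Complex.I_re, mul_zero, sub_zero]

/-- A Phragmén–Lindelöf principle in a vertical strip for functions of finite order. -/
theorem exists_norm_le_exp_abs_im_of_strip {F : ℂ → ℂ} (hF : IsEntireOfFiniteOrder F)
    {a b C D : ℝ} (hab : a < b)
    (ha : ∀ s : ℂ, s.re = a → ‖F s‖ ≤ Real.exp (C + D * |s.im|))
    (hb : ∀ s : ℂ, s.re = b → ‖F s‖ ≤ Real.exp (C + D * |s.im|)) :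
    ∃ C' D' : ℝ, 0 ≤ C' ∧ 0 ≤ D' ∧
      ∀ s : ℂ, a ≤ s.re → s.re ≤ b → ‖F s‖ ≤ Real.exp (C' + D' * |s.im|) := by
  obtain ⟨hFd, A, hA⟩ := hF
  have hw : 0 < b - a := sub_pos.2 hab
  -- This scaling sends the strip to `|Re u| ≤ 1 / 2`, where the cosine of the real part is at least
  -- `1 / 2`. It is also below the critical rate `π / (b - a)` of the Phragmén–Lindelöf principle.
  set c : ℝ := 1 / (b - a) with hc
  have hc0 : 0 < c := by positivity
  obtain ⟨N, hN⟩ := exists_nat_ge (D / c)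
  have hNc : D ≤ N * c := (div_le_iff₀ hc0).1 hN
  set u : ℂ → ℂ := fun s ↦ (c : ℂ) * (s - ((a + b) / 2 : ℝ)) with hu
  have hure : ∀ s, (u s).re = c * (s.re - (a + b) / 2) := fun s ↦ by
    simp only [hu, Complex.re_ofReal_mul, Complex.sub_re, Complex.ofReal_re]
  have huim : ∀ s, (u s).im = c * s.im := fun s ↦ by
    simp only [hu, Complex.im_ofReal_mul, Complex.sub_im, Complex.ofReal_im, sub_zero]
  -- A comparison function of size about `exp (N c |Im s|)` on the strip, with `N c ≥ D`: the
  -- quotient `F / H` is bounded on both edges. The factor `4` makes up for `cos ≥ 1 / 2` and `cosh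
  -- t ≥ exp |t| / 2`, so that `‖H‖ ≥ 1`.
  set H : ℂ → ℂ := fun s ↦ (4 * Complex.cos (u s)) ^ N with hH
  have hlow : ∀ s : ℂ, a ≤ s.re → s.re ≤ b → Real.exp (N * c * |s.im|) ≤ ‖H s‖ := by
    intro s h1 h2
    have hx : |(u s).re| ≤ 1 / 2 := by
      rw [hure, abs_mul, abs_of_pos hc0]
      calc c * |s.re - (a + b) / 2| ≤ c * ((b - a) / 2) := by
            gcongr; exact abs_le.2 ⟨by linarith, by linarith⟩
        _ = 1 / 2 := by rw [hc]; field_simp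
    have hcos : 1 / 2 ≤ Real.cos (u s).re := by
      refine le_trans ?_ (Real.one_sub_sq_div_two_le_cos (x := (u s).re))
      nlinarith [abs_le.1 hx]
    have hcosh : Real.exp |(u s).im| / 2 ≤ Real.cosh (u s).im := by
      rw [← Real.cosh_abs, Real.cosh_eq]
      linarith [Real.exp_pos (-|(u s).im|)]
    have hre : Real.cos (u s).re * Real.cosh (u s).im ≤ ‖Complex.cos (u s)‖ := by
      rw [← re_cos]
      exact (le_abs_self _).trans (Complex.abs_re_le_norm _)
    have h4 : Real.exp |(u s).im| ≤ 4 * ‖Complex.cos (u s)‖ := by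
      have := mul_le_mul hcos hcosh (by positivity) (by linarith)
      linarith
    calc Real.exp (N * c * |s.im|) = Real.exp |(u s).im| ^ N := by
          rw [← Real.exp_nat_mul, huim, abs_mul, abs_of_pos hc0, mul_assoc]
      _ ≤ (4 * ‖Complex.cos (u s)‖) ^ N := by gcongr
      _ = ‖H s‖ := by simp [hH]
  have hup : ∀ s : ℂ, ‖H s‖ ≤ Real.exp (N * 4 + N * c * |s.im|) := by
    intro s
    have hcos : ‖Complex.cos (u s)‖ ≤ Real.exp |(u s).im| := by
      have := norm_sin_le_exp (Real.pi / 2 - u s)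
      rw [Complex.sin_pi_div_two_sub] at this
      have him : ((Real.pi : ℂ) / 2 - u s).im = -(u s).im := by
        rw [Complex.sub_im, show ((Real.pi : ℂ) / 2) = ((Real.pi / 2 : ℝ) : ℂ) by push_cast; rfl,
          Complex.ofReal_im, zero_sub]
      rwa [him, abs_neg] at this
    calc ‖H s‖ = (4 * ‖Complex.cos (u s)‖) ^ N := by simp [hH]
      _ ≤ (Real.exp 4 * Real.exp |(u s).im|) ^ N := by
          gcongr
          linarith [Real.add_one_le_exp (4 : ℝ)]
      _ = _ := by
          rw [← Real.exp_add, ← Real.exp_nat_mul, huim, abs_mul, abs_of_pos hc0]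
          congr 1; ring
  have hud : Differentiable ℂ u := by simp only [hu]; fun_prop
  have hHd : Differentiable ℂ H := (hud.ccos.const_mul 4).pow N
  have hH1 : ∀ s : ℂ, a ≤ s.re → s.re ≤ b → 1 ≤ ‖H s‖ := fun s h1 h2 ↦
    le_trans (Real.one_le_exp (by positivity)) (hlow s h1 h2)
  have hcl : closure (Complex.re ⁻¹' Set.Ioo a b) = Complex.re ⁻¹' Set.Icc a b := by
    rw [Complex.closure_preimage_re, closure_Ioo hab.ne]
  have hPL : ∀ s : ℂ, a ≤ s.re → s.re ≤ b → ‖F s / H s‖ ≤ Real.exp C := by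
    intro s hs1 hs2
    refine PhragmenLindelof.vertical_strip (f := fun s ↦ F s / H s) (a := a) (b := b) ?_ ?_ ?_ ?_
      hs1 hs2
    · refine DifferentiableOn.diffContOnCl ?_
      rw [hcl]
      refine hFd.differentiableOn.div hHd.differentiableOn fun z hz h0 ↦ ?_
      have := hH1 z hz.1 hz.2
      rw [h0, norm_zero] at this
      linarith
    · refine ⟨c, ?_, 1, ?_⟩
      · rw [hc]
        gcongr
        linarith [Real.pi_gt_three]
      · have hle : comap (_root_.abs ∘ Complex.im) atTop ⊓ 𝓟 (Complex.re ⁻¹' Set.Ioo a b) ≤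
            Bornology.cobounded ℂ := by
          refine inf_le_left.trans ?_
          rw [← comap_norm_atTop]
          refine tendsto_iff_comap.1 ?_
          exact tendsto_atTop_mono Complex.abs_im_le_norm tendsto_comap
        refine Asymptotics.IsBigO.trans (g := F) ?_ ((hA.mono hle).trans ?_)
        · refine Asymptotics.IsBigO.of_bound 1 ?_
          filter_upwards [mem_inf_of_right (mem_principal_self _)] with z hz
          rw [norm_div, one_mul]
          exact div_le_self (norm_nonneg _) (hH1 z hz.1.le hz.2.le)
        · set R : ℝ := |a| + |b| + 1
          have hX : 1 ≤ R := by simp only [R]; linarith [abs_nonneg a, abs_nonneg b]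
          have hlim : ∀ᶠ x : ℝ in atTop, (x + R) ^ |A| ≤ Real.exp (c * x) := by
            have h1 := (isLittleO_rpow_exp_pos_mul_atTop |A| hc0).def
              (show 0 < Real.exp (-(c * R)) by positivity)
            have h2 := (tendsto_atTop_add_const_right atTop R tendsto_id).eventually h1
            filter_upwards [h2, eventually_ge_atTop 0] with x hx hx0
            rw [Real.norm_of_nonneg (by simp only [id]; positivity),
              Real.norm_of_nonneg (by positivity), ← Real.exp_add] at hx
            refine hx.trans (le_of_eq ?_)
            congr 1
            simp only [id]; ring
          refine Asymptotics.IsBigO.of_bound 1 ?_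
          have h3 : ∀ᶠ z : ℂ in comap (_root_.abs ∘ Complex.im) atTop ⊓
              𝓟 (Complex.re ⁻¹' Set.Ioo a b), (|z.im| + R) ^ |A| ≤ Real.exp (c * |z.im|) :=
            mem_inf_of_left (tendsto_comap.eventually hlim)
          have h4 : ∀ᶠ z : ℂ in comap (_root_.abs ∘ Complex.im) atTop ⊓
              𝓟 (Complex.re ⁻¹' Set.Ioo a b), 1 ≤ |z.im| :=
            mem_inf_of_left (tendsto_comap.eventually (eventually_ge_atTop 1))
          filter_upwards [mem_inf_of_right (mem_principal_self _), h3, h4] with z hz hz3 hz4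
          rw [Real.norm_of_nonneg (by positivity), Real.norm_of_nonneg (by positivity), one_mul,
            one_mul]
          refine Real.exp_le_exp.2 (le_trans ?_ hz3)
          have hz1 : 1 ≤ ‖z‖ := hz4.trans (Complex.abs_im_le_norm z)
          have hzX : ‖z‖ ≤ |z.im| + R := by
            have h5 := Complex.norm_le_abs_re_add_abs_im z
            have h6 : |z.re| ≤ |a| + |b| := by
              refine abs_le.2 ⟨?_, ?_⟩
              · linarith [hz.1, neg_abs_le a, abs_nonneg b]
              · linarith [hz.2, le_abs_self b, abs_nonneg a]
            simp only [R]; linarith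
          exact (Real.rpow_le_rpow_of_exponent_le hz1 (le_abs_self A)).trans
            (Real.rpow_le_rpow (norm_nonneg _) hzX (abs_nonneg A))
    all_goals
      intro z hz
      have hlz := hlow z (by linarith) (by linarith)
      rw [norm_div, div_le_iff₀ (by linarith [Real.exp_pos (N * c * |z.im|)])]
      first | refine (ha z hz).trans ?_ | refine (hb z hz).trans ?_
      rw [Real.exp_add]
      gcongr
      refine le_trans (Real.exp_le_exp.2 ?_) hlz
      gcongr
  refine ⟨|C| + N * 4, N * c, by positivity, by positivity, fun s hs1 hs2 ↦ ?_⟩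
  have h1 := hPL s hs1 hs2
  have h2 : 0 < ‖H s‖ := by linarith [hH1 s hs1 hs2]
  rw [norm_div, div_le_iff₀ h2] at h1
  calc ‖F s‖ ≤ Real.exp |C| * Real.exp (N * 4 + N * c * |s.im|) :=
        h1.trans (by gcongr; exacts [le_abs_self C, hup s])
    _ = _ := by rw [← Real.exp_add]; congr 1; ring

open Asymptotics ValueDistribution

/-- Analytic input on `L`-functions: exponential convergence to `1` in a right half-plane, and
order at most one of the entire function obtained by clearing the pole. -/
theorem IsLFunction.exists_growth {L : ℂ → ℂ} (h : IsLFunction L) :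
    ∃ (k : ℕ) (F : ℂ → ℂ) (C₀ : ℝ), Differentiable ℂ F ∧ (∀ s : ℂ, s ≠ 1 → (s - 1) ^ k * L s = F s) ∧
      0 ≤ C₀ ∧ (∀ s : ℂ, 2 ≤ s.re → ‖L s - 1‖ ≤ C₀ * 2 ^ (-s.re)) ∧
      ∀ q : ℝ, 1 < q → ∃ C : ℝ, 0 ≤ C ∧ ∀ s : ℂ, ‖F s‖ ≤ Real.exp (C * (1 + ‖s‖) ^ q) := by
  obtain ⟨⟨a, ha1, ha, hLa⟩, ⟨k, F, hF, hLF⟩, ⟨K, Q, lam, mu, ω, hFE⟩⟩ := h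
  obtain ⟨C₀, hC₀, hbound⟩ := norm_LSeries_sub_one_le ha1 ha
  have hL1 : ∀ s : ℂ, 2 ≤ s.re → ‖L s - 1‖ ≤ C₀ * 2 ^ (-s.re) := fun s hs ↦ by
    rw [hLa s (by linarith)]; exact hbound s hs
  refine ⟨k, F, C₀, hF.1, hLF, hC₀, hL1, fun q hq ↦ ?_⟩
  have hcont : ∀ s : ℂ, s ≠ 1 → ContinuousAt L s := by
    intro s hs
    have h1 : ContinuousAt (fun z ↦ F z / (z - 1) ^ k) s :=
      hF.1.continuous.continuousAt.div (by fun_prop) (pow_ne_zero _ (sub_ne_zero.2 hs))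
    refine h1.congr ?_
    filter_upwards [isOpen_ne.mem_nhds hs] with z hz
    rw [← hLF z hz, mul_div_cancel_left₀ _ (pow_ne_zero _ (sub_ne_zero.2 hz))]
  obtain ⟨M, C, D, hM, hC, hD, hleft⟩ :=
    exists_norm_le_exp_of_satisfiesFE hC₀ hL1 hcont hFE hq
  have hright : ∀ s : ℂ, 2 ≤ s.re → ‖L s‖ ≤ Real.exp C₀ := by
    intro s hs
    have h3 : (2 : ℝ) ^ (-s.re) ≤ 1 :=
      Real.rpow_le_one_of_one_le_of_nonpos (by norm_num) (by linarith)
    calc ‖L s‖ = ‖(L s - 1) + 1‖ := by ring_nf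
      _ ≤ ‖L s - 1‖ + 1 := (norm_add_le _ _).trans (by simp)
      _ ≤ C₀ * 1 + 1 := by gcongr; exact (hL1 s hs).trans (by gcongr)
      _ = C₀ + 1 := by ring
      _ ≤ _ := Real.add_one_le_exp C₀
  have hpow : ∀ s : ℂ, ‖(s - 1) ^ k‖ ≤ Real.exp (k * (1 + |s.re| + |s.im|)) := by
    intro s
    rw [norm_pow, Real.exp_nat_mul]
    gcongr
    have h1 : ‖s - 1‖ ≤ |s.re| + |s.im| + 1 :=
      (norm_sub_le _ _).trans (by simpa using Complex.norm_le_abs_re_add_abs_im s)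
    linarith [Real.add_one_le_exp (1 + |s.re| + |s.im|)]
  have hFnorm : ∀ s : ℂ, s ≠ 1 → ‖F s‖ = ‖(s - 1) ^ k‖ * ‖L s‖ := fun s hs ↦ by
    rw [← hLF s hs, norm_mul]
  -- The strip bound is applied to `F`, in which the pole is cleared. The functional equation
  -- controls the edge `Re s = -M`, the Dirichlet series the edge `Re s = 2`; the constants dominate
  -- the two resulting bounds.
  obtain ⟨C₁, D₁, hC₁, hD₁, hstrip⟩ := exists_norm_le_exp_abs_im_of_strip hF
    (a := -M) (b := 2) (C := k * (1 + M + 2) + C₀ + C * (1 + M) ^ q + D) (D := k + D)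
    (by linarith)
    (fun s hs ↦ by
      rw [hFnorm s (by rintro rfl; simp at hs; linarith)]
      refine (mul_le_mul (hpow s) (hleft s hs.le) (norm_nonneg _) (Real.exp_pos _).le).trans ?_
      rw [← Real.exp_add]
      refine Real.exp_le_exp.2 ?_
      have : |s.re| = M := by rw [hs, abs_neg, abs_of_nonneg (by linarith)]
      rw [this]
      nlinarith [Nat.cast_nonneg (α := ℝ) k])
    (fun s hs ↦ by
      rw [hFnorm s (by rintro rfl; simp at hs)]
      refine (mul_le_mul (hpow s) (hright s hs.ge) (norm_nonneg _) (Real.exp_pos _).le).trans ?_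
      rw [← Real.exp_add]
      refine Real.exp_le_exp.2 ?_
      rw [hs, abs_two]
      have : 0 ≤ C * (1 + M) ^ q := by positivity
      nlinarith [Nat.cast_nonneg (α := ℝ) k, mul_nonneg hD (abs_nonneg s.im),
        mul_nonneg (Nat.cast_nonneg (α := ℝ) k) (by linarith : (0 : ℝ) ≤ M)])
  refine ⟨2 * k + C₀ + C + D + C₁ + D₁, by positivity, fun s ↦ ?_⟩
  have hx1 : 1 ≤ 1 + ‖s‖ := by linarith [norm_nonneg s]
  have hxq : 1 + ‖s‖ ≤ (1 + ‖s‖) ^ q := by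
    simpa using Real.rpow_le_rpow_of_exponent_le hx1 hq.le
  set Y := (1 + ‖s‖) ^ q
  have hY1 : 1 ≤ Y := hx1.trans hxq
  have hre := Complex.abs_re_le_norm s
  have him := Complex.abs_im_le_norm s
  have hpowY : ‖(s - 1) ^ k‖ ≤ Real.exp (2 * k * Y) := by
    refine (hpow s).trans (Real.exp_le_exp.2 ?_)
    calc (k : ℝ) * (1 + |s.re| + |s.im|) ≤ k * (2 * Y) := by gcongr; linarith
      _ = _ := by ring
  have hk0 : 0 ≤ (k : ℝ) * Y := by positivity
  have h0 : 0 ≤ C₀ * Y := by positivity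
  have h1 : 0 ≤ C * Y := by positivity
  have h2 : 0 ≤ D * Y := by positivity
  have h3 : 0 ≤ C₁ * Y := by positivity
  have h4 : 0 ≤ D₁ * Y := by positivity
  rcases le_total s.re (-M) with hs | hs
  · rw [hFnorm s (by rintro rfl; simp at hs; linarith)]
    refine (mul_le_mul hpowY (hleft s hs) (norm_nonneg _) (Real.exp_pos _).le).trans ?_
    rw [← Real.exp_add]
    refine Real.exp_le_exp.2 ?_
    have b1 : C * (1 + |s.re|) ^ q ≤ C * Y := by simp only [Y]; gcongr
    have b2 : D * (1 + |s.im|) ≤ D * Y := by gcongr; linarith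
    linarith
  rcases le_total s.re 2 with hs2 | hs2
  · refine (hstrip s hs hs2).trans (Real.exp_le_exp.2 ?_)
    have b1 : C₁ * 1 ≤ C₁ * Y := by gcongr
    have b2 : D₁ * |s.im| ≤ D₁ * Y := by gcongr; linarith
    linarith
  · rw [hFnorm s (by rintro rfl; norm_num at hs2)]
    refine (mul_le_mul hpowY (hright s hs2) (norm_nonneg _) (Real.exp_pos _).le).trans ?_
    rw [← Real.exp_add]
    refine Real.exp_le_exp.2 ?_
    have b1 : C₀ * 1 ≤ C₀ * Y := by gcongr
    linarith

/-! ### Growth of the Nevanlinna characteristic -/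

theorem characteristic_eq_proximity_of_differentiable {f : ℂ → ℂ} (hf : Differentiable ℂ f) :
    characteristic f ⊤ = proximity f ⊤ := by
  have h1 := logCounting_add_analyticOn (f := (0 : ℂ → ℂ)) (g := f)
    (fun z ↦ MeromorphicAt.const 0 z)
    ((Complex.analyticOnNhd_univ_iff_differentiable.2 hf).analyticOn)
  rw [zero_add, logCounting_const_zero] at h1
  rw [characteristic, h1, add_zero]

theorem posLog_exp (b : ℝ) : Real.posLog (Real.exp b) = max 0 b := by
  rw [Real.posLog_apply, Real.log_exp]

theorem characteristic_le_of_norm_le_exp {f : ℂ → ℂ} (hf : Differentiable ℂ f) {r b : ℝ}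
    (hr : 0 < r) (hb : 0 ≤ b) (h : ∀ z : ℂ, ‖z‖ = r → ‖f z‖ ≤ Real.exp b) :
    characteristic f ⊤ r ≤ b := by
  rw [characteristic_eq_proximity_of_differentiable hf, proximity_top]
  have hm : Meromorphic f := fun z ↦ (hf.analyticAt z).meromorphicAt
  refine Real.circleAverage_mono_on_of_le_circle hm.meromorphicOn.circleIntegrable_posLog_norm
    fun z hz ↦ ?_
  have hz' : ‖z‖ = r := by simpa [abs_of_pos hr] using hz
  refine (Real.posLog_le_posLog (norm_nonneg _) (h z hz')).trans (le_of_eq ?_)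
  rw [posLog_exp, max_eq_right hb]

theorem isBigO_const_rpow {A : ℝ} (hA : 0 ≤ A) (c : ℝ) :
    (fun _ : ℝ ↦ c) =O[atTop] fun r : ℝ ↦ r ^ A := by
  refine IsBigO.of_bound |c| ?_
  filter_upwards [eventually_ge_atTop 1] with r hr
  have h1 : 1 ≤ r ^ A := Real.one_le_rpow hr hA
  rw [Real.norm_eq_abs, Real.norm_of_nonneg (by linarith)]
  exact le_mul_of_one_le_right (abs_nonneg c) h1

theorem isBigO_characteristic_of_le {f : ℂ → ℂ} {g : ℝ → ℝ} {A : ℝ}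
    (hg : g =O[atTop] fun r : ℝ ↦ r ^ A) (h : ∀ᶠ r in atTop, characteristic f ⊤ r ≤ g r) :
    characteristic f ⊤ =O[atTop] fun r : ℝ ↦ r ^ A := by
  refine IsBigO.trans (IsBigO.of_bound 1 ?_) hg
  filter_upwards [h, characteristic_eventually_nonneg (f := f) (a := ⊤)] with r h1 h2
  rw [one_mul, Real.norm_of_nonneg h2]
  exact h1.trans (le_abs_self _)

theorem isBigO_characteristic_congr {f g : ℂ → ℂ} {A : ℝ} (hfg : f =ᶠ[codiscrete ℂ] g)
    (h : characteristic f ⊤ =O[atTop] fun r : ℝ ↦ r ^ A) :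
    characteristic g ⊤ =O[atTop] fun r : ℝ ↦ r ^ A := by
  refine h.congr' ?_ EventuallyEq.rfl
  filter_upwards [eventually_ne_atTop 0] with r hr
  exact characteristic_congr_codiscrete hfg hr

theorem isBigO_characteristic_add {f g : ℂ → ℂ} {A : ℝ} (hA : 0 ≤ A) (hf : Meromorphic f)
    (hg : Meromorphic g) (h1 : characteristic f ⊤ =O[atTop] fun r : ℝ ↦ r ^ A)
    (h2 : characteristic g ⊤ =O[atTop] fun r : ℝ ↦ r ^ A) :
    characteristic (f + g) ⊤ =O[atTop] fun r : ℝ ↦ r ^ A :=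
  isBigO_characteristic_of_le ((h1.add h2).add (isBigO_const_rpow hA _))
    (characteristic_add_top_eventuallyLE hf hg)

theorem isBigO_characteristic_mul {f g : ℂ → ℂ} {A : ℝ} (hf : Meromorphic f)
    (hf0 : ∀ z, meromorphicOrderAt f z ≠ ⊤) (hg : Meromorphic g)
    (hg0 : ∀ z, meromorphicOrderAt g z ≠ ⊤)
    (h1 : characteristic f ⊤ =O[atTop] fun r : ℝ ↦ r ^ A)
    (h2 : characteristic g ⊤ =O[atTop] fun r : ℝ ↦ r ^ A) :
    characteristic (f * g) ⊤ =O[atTop] fun r : ℝ ↦ r ^ A :=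
  isBigO_characteristic_of_le (h1.add h2) (characteristic_mul_top_eventuallyLE hf hf0 hg hg0)

theorem isBigO_characteristic_inv {f : ℂ → ℂ} {A : ℝ} (hA : 0 ≤ A) (hf : Meromorphic f)
    (h : characteristic f ⊤ =O[atTop] fun r : ℝ ↦ r ^ A) :
    characteristic f⁻¹ ⊤ =O[atTop] fun r : ℝ ↦ r ^ A := by
  have h1 := (isBigO_characteristic_sub_characteristic_inv hf).trans (isBigO_const_rpow hA 1)
  simpa using h.sub h1

theorem isBigO_characteristic_const {A : ℝ} (hA : 0 ≤ A) (c : ℂ) :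
    characteristic (fun _ : ℂ ↦ c) ⊤ =O[atTop] fun r : ℝ ↦ r ^ A := by
  refine isBigO_characteristic_of_le (isBigO_const_rpow hA (Real.posLog ‖c‖)) (.of_forall fun r ↦ ?_)
  simp [characteristic]

theorem characteristic_neg (f : ℂ → ℂ) : characteristic (-f) ⊤ = characteristic f ⊤ := by
  have hdiv : MeromorphicOn.divisor (-f) Set.univ = MeromorphicOn.divisor f Set.univ := by
    have hiff : MeromorphicOn (-f) Set.univ ↔ MeromorphicOn f Set.univ :=
      ⟨fun h ↦ by simpa using h.neg, fun h ↦ h.neg⟩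
    ext z
    simp only [MeromorphicOn.divisor_def, ← meromorphicOrderAt_neg]
    -- The divisor of a function that is not meromorphic is `0` by default, so the identity survives
    -- for arbitrary `f`.
    by_cases hf : MeromorphicOn f Set.univ
    · simp [hf, hiff.2 hf]
    · simp [hf, mt hiff.1 hf]
  rw [characteristic, characteristic, logCounting_top, logCounting_top, hdiv, proximity_top,
    proximity_top]
  simp

theorem isBigO_characteristic_sub {f g : ℂ → ℂ} {A : ℝ} (hA : 0 ≤ A) (hf : Meromorphic f)
    (hg : Meromorphic g) (h1 : characteristic f ⊤ =O[atTop] fun r : ℝ ↦ r ^ A)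
    (h2 : characteristic g ⊤ =O[atTop] fun r : ℝ ↦ r ^ A) :
    characteristic (f - g) ⊤ =O[atTop] fun r : ℝ ↦ r ^ A := by
  rw [sub_eq_add_neg]
  exact isBigO_characteristic_add hA hf hg.neg h1 (by rwa [characteristic_neg])

theorem isBigO_characteristic_of_norm_le_exp {f : ℂ → ℂ} (hf : Differentiable ℂ f) {A C : ℝ}
    (hA : 0 ≤ A) (hC : 0 ≤ C) (h : ∀ z, ‖f z‖ ≤ Real.exp (C * (1 + ‖z‖) ^ A)) :
    characteristic f ⊤ =O[atTop] fun r : ℝ ↦ r ^ A := by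
  refine isBigO_characteristic_of_le (g := fun r ↦ (C * 2 ^ A) * r ^ A)
    ((isBigO_refl _ _).const_mul_left _) ?_
  filter_upwards [eventually_ge_atTop 1] with r hr
  refine characteristic_le_of_norm_le_exp hf (by linarith) (by positivity) fun z hz ↦ ?_
  refine (h z).trans (Real.exp_le_exp.2 ?_)
  rw [hz, mul_assoc, ← Real.mul_rpow zero_le_two (by linarith)]
  gcongr
  linarith

theorem meromorphic_sub_one_zpow (m : ℤ) : Meromorphic fun z : ℂ ↦ (z - 1) ^ m := by
  intro z; fun_prop

theorem isBigO_characteristic_sub_one_zpow {A : ℝ} (hA : 1 ≤ A) (m : ℤ) :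
    characteristic (fun z : ℂ ↦ (z - 1) ^ m) ⊤ =O[atTop] fun r : ℝ ↦ r ^ A := by
  have key : ∀ n : ℕ, characteristic (fun z : ℂ ↦ (z - 1) ^ n) ⊤ =O[atTop] fun r : ℝ ↦ r ^ A := by
    intro n
    refine isBigO_characteristic_of_norm_le_exp (by fun_prop) (by linarith) (Nat.cast_nonneg n)
      fun z ↦ ?_
    rw [norm_pow, Real.exp_nat_mul]
    gcongr
    have h1 : ‖z - 1‖ ≤ 1 + ‖z‖ := (norm_sub_le _ _).trans (by simp [add_comm])
    have h2 : 1 + ‖z‖ ≤ (1 + ‖z‖) ^ A := by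
      simpa using Real.rpow_le_rpow_of_exponent_le
        (show 1 ≤ 1 + ‖z‖ by linarith [norm_nonneg z]) hA
    linarith [Real.add_one_le_exp ((1 + ‖z‖) ^ A)]
  obtain ⟨n, rfl | rfl⟩ := m.eq_nat_or_neg
  · simpa using key n
  · have := isBigO_characteristic_inv (by linarith) (by intro z; fun_prop) (key n)
    convert this using 2
    ext z; simp

/-- The characteristic of an exponential controls the circle means of the real part. -/
theorem circleAverage_abs_re_eq {g : ℂ → ℂ} (hg : Differentiable ℂ g) (r : ℝ) :
    Real.circleAverage (fun z ↦ |(g z).re|) 0 r =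
      2 * characteristic (fun z ↦ Complex.exp (g z)) ⊤ r - (g 0).re := by
  rw [characteristic_eq_proximity_of_differentiable hg.cexp, proximity_top]
  have hre : Real.circleAverage (fun z ↦ (g z).re) 0 r = (g 0).re := by
    have h1 := (hg.diffContOnCl (s := Metric.ball 0 |r|)).circleAverage
    have h2 := Complex.reCLM.circleAverage_comp_comm (c := 0) (R := r) (f := g)
      (hg.continuous.continuousOn.circleIntegrable')
    rw [h1] at h2
    simpa [Function.comp_def] using h2
  -- This is `|x| = 2 max(0, x) - x`; the subtracted term has mean `Re (g 0)`.
  have hpl : (fun z ↦ |(g z).re|) =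
      (fun z ↦ (2 : ℝ) • Real.posLog ‖Complex.exp (g z)‖) - fun z ↦ (g z).re := by
    ext z
    rw [Pi.sub_apply, Complex.norm_exp, posLog_exp, smul_eq_mul]
    rcases le_total 0 (g z).re with h | h
    · rw [max_eq_right h, abs_of_nonneg h]; ring
    · rw [max_eq_left h, abs_of_nonpos h]; ring
  have hm : Meromorphic fun z ↦ Complex.exp (g z) := fun z ↦ (hg.cexp.analyticAt z).meromorphicAt
  have hi : CircleIntegrable (fun z ↦ Real.posLog ‖Complex.exp (g z)‖) 0 r :=
    hm.meromorphicOn.circleIntegrable_posLog_norm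
  have hi2 : CircleIntegrable (fun z ↦ (2 : ℝ) • Real.posLog ‖Complex.exp (g z)‖) 0 r :=
    hi.const_smul
  have hi3 : CircleIntegrable (fun z ↦ (g z).re) 0 r :=
    (Complex.continuous_re.comp hg.continuous).continuousOn.circleIntegrable'
  rw [hpl, Real.circleAverage_sub hi2 hi3, Real.circleAverage_fun_smul, hre, smul_eq_mul]

/-! ### The order -/

theorem isBigO_of_nevanlinnaOrder_lt {f : ℂ → ℂ} {x : ℝ} (h : nevanlinnaOrder f < (x : EReal)) :
    characteristic f ⊤ =O[atTop] fun r : ℝ ↦ r ^ x := by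
  have h1 := eventually_lt_of_limsup_lt h
  refine isBigO_characteristic_of_le (isBigO_refl _ _) ?_
  filter_upwards [h1, eventually_gt_atTop 1] with r hr hr1
  have hlog : 0 < Real.log r := Real.log_pos hr1
  have h2 : Real.posLog (characteristic f ⊤ r) < x * Real.log r :=
    (div_lt_iff₀ hlog).1 (EReal.coe_lt_coe_iff.1 hr)
  rw [Real.posLog_apply] at h2
  have h3 := (le_max_right _ _).trans_lt h2
  rcases le_or_gt (characteristic f ⊤ r) 0 with h0 | h0
  · exact h0.trans (by positivity)
  · rw [Real.rpow_def_of_pos (by linarith), mul_comm (Real.log r)]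
    exact ((Real.log_lt_iff_lt_exp h0).1 h3).le

theorem nevanlinnaOrder_le_of_isBigO {f : ℂ → ℂ} {x y : ℝ} (hx : 0 ≤ x) (hxy : x < y)
    (h : characteristic f ⊤ =O[atTop] fun r : ℝ ↦ r ^ x) :
    nevanlinnaOrder f ≤ (y : EReal) := by
  obtain ⟨C, hC⟩ := h.bound
  have h1 : ∀ᶠ r : ℝ in atTop, C ≤ r ^ (y - x) :=
    (tendsto_rpow_atTop (sub_pos.2 hxy)).eventually_ge_atTop C
  refine limsup_le_of_le (h := ?_)
  filter_upwards [hC, h1, eventually_gt_atTop 1] with r hr hr1 hr2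
  have hr0 : 0 < r := by linarith
  have hlog : 0 < Real.log r := Real.log_pos hr2
  refine EReal.coe_le_coe_iff.2 ((div_le_iff₀ hlog).2 ?_)
  have h2 : characteristic f ⊤ r ≤ r ^ y := by
    refine (le_abs_self _).trans (hr.trans ?_)
    rw [Real.norm_of_nonneg (by positivity)]
    calc C * r ^ x ≤ r ^ (y - x) * r ^ x := by gcongr
      _ = r ^ y := by rw [← Real.rpow_add hr0]; congr 1; ring
  refine (Real.posLog_le_posLog (characteristic_nonneg hr2.le) h2).trans ?_
  rw [Real.posLog_apply, Real.log_rpow hr0]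
  exact max_le (by have := hx.trans hxy.le; positivity) le_rfl

theorem one_le_nevanlinnaOrder {f : ℂ → ℂ} {c : ℝ} (hc : 0 < c)
    (h : ∀ᶠ r : ℝ in atTop, c * r ≤ characteristic f ⊤ r) : 1 ≤ nevanlinnaOrder f := by
  by_contra! hlt
  obtain ⟨x, hx1, hx2⟩ := EReal.lt_iff_exists_real_btwn.1 hlt
  have hx : x < 1 := by exact_mod_cast hx2
  obtain ⟨C, hC⟩ := (isBigO_of_nevanlinnaOrder_lt hx1).bound
  have h1 : ∀ᶠ r : ℝ in atTop, C / c < r ^ (1 - x) :=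
    (tendsto_rpow_atTop (sub_pos.2 hx)).eventually_gt_atTop _
  obtain ⟨r, hr1, hr2, hr3, hr4⟩ := (h.and (hC.and (h1.and (eventually_gt_atTop 0)))).exists
  have h2 : c * r ≤ C * r ^ x := by
    refine hr1.trans ((le_abs_self _).trans (hr2.trans (le_of_eq ?_)))
    rw [Real.norm_of_nonneg (by positivity)]
  rw [div_lt_iff₀ hc] at hr3
  have h3 : C * r ^ x < r ^ (1 - x) * c * r ^ x := by gcongr
  have h4 : r ^ (1 - x) * c * r ^ x = c * r := by
    rw [mul_right_comm, ← Real.rpow_add hr4, sub_add_cancel, Real.rpow_one, mul_comm]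
  linarith

/-! ### Meromorphic functions with at most one zero or pole -/

theorem meromorphicOrderAt_sub_one_zpow_of_ne {z : ℂ} (hz : z ≠ 1) (m : ℤ) :
    meromorphicOrderAt (fun w : ℂ ↦ (w - 1) ^ m) z = 0 := by
  have h0 : z - 1 ≠ 0 := sub_ne_zero.2 hz
  have han : AnalyticAt ℂ (fun w : ℂ ↦ (w - 1) ^ m) z := by
    have h1 : AnalyticAt ℂ (fun w : ℂ ↦ w - 1) z := by fun_prop
    exact h1.fun_zpow h0
  exact han.meromorphicNFAt.meromorphicOrderAt_eq_zero_iff.2 (zpow_ne_zero m h0)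

theorem meromorphicOrderAt_sub_one_zpow_ne_top (m : ℤ) (z : ℂ) :
    meromorphicOrderAt (fun w : ℂ ↦ (w - 1) ^ m) z ≠ ⊤ := by
  rcases eq_or_ne z 1 with rfl | hz
  · rw [fun_meromorphicOrderAt_zpow_id_sub_const]; exact WithTop.coe_ne_top
  · rw [meromorphicOrderAt_sub_one_zpow_of_ne hz]; exact WithTop.zero_ne_top

/-- Division by a power of `z - 1` leaves a zero-free entire function `exp g`. Its characteristic
controls the circle means of `|Re g|`, hence the Taylor coefficients of `g`, and those of index
above `A` vanish. -/
theorem exists_eq_zpow_mul_exp_of_isBigO {G : ℂ → ℂ} (hG : Meromorphic G)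
    (h0 : ∀ z, z ≠ 1 → meromorphicOrderAt G z = 0) (h1 : meromorphicOrderAt G 1 ≠ ⊤) {A : ℝ}
    (hA : 1 ≤ A) (hT : characteristic G ⊤ =O[atTop] fun r : ℝ ↦ r ^ A) :
    ∃ (m : ℤ) (p : ℂ[X]), (p.natDegree : ℝ) ≤ A ∧
      G =ᶠ[codiscrete ℂ] fun z ↦ (z - 1) ^ m * Complex.exp (p.eval z) := by
  set m := (meromorphicOrderAt G 1).untop₀ with hm
  set P : ℂ → ℂ := fun z ↦ (z - 1) ^ (-m)
  have hP : Meromorphic P := meromorphic_sub_one_zpow _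
  have hGP : Meromorphic (G * P) := fun z ↦ (hG z).mul (hP z)
  have hord : ∀ z, meromorphicOrderAt (G * P) z = 0 := by
    intro z
    rw [meromorphicOrderAt_mul (hG z) (hP z)]
    rcases eq_or_ne z 1 with rfl | hz
    · rw [fun_meromorphicOrderAt_zpow_id_sub_const, ← WithTop.coe_untop₀_of_ne_top h1, ← hm,
        ← WithTop.coe_add, add_neg_cancel, WithTop.coe_zero]
    · rw [h0 z hz, meromorphicOrderAt_sub_one_zpow_of_ne hz, add_zero]
  -- Order zero only describes punctured neighbourhoods; passing to normal form corrects the values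
  -- at exceptional points, so that `E` is truly entire and nowhere zero.
  set E := toMeromorphicNFOn (G * P) Set.univ
  have hE : MeromorphicNFOn E Set.univ := meromorphicNFOn_toMeromorphicNFOn _ _
  have hEeq : G * P =ᶠ[codiscrete ℂ] E :=
    toMeromorphicNFOn_eqOn_codiscrete (meromorphicOn_univ.2 hGP)
  have hEord : ∀ z, meromorphicOrderAt E z = 0 := fun z ↦ by
    rw [meromorphicOrderAt_toMeromorphicNFOn (meromorphicOn_univ.2 hGP) trivial, hord z]
  have hEd : Differentiable ℂ E := fun z ↦
    (((hE (Set.mem_univ z)).meromorphicOrderAt_nonneg_iff_analyticAt).1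
      (hEord z).ge).differentiableAt
  have hE0 : ∀ z, E z ≠ 0 := fun z ↦
    ((hE (Set.mem_univ z)).meromorphicOrderAt_eq_zero_iff).1 (hEord z)
  obtain ⟨g, hg, hgE⟩ := exists_eq_exp_of_differentiable hEd hE0
  have hGtop : ∀ z, meromorphicOrderAt G z ≠ ⊤ := fun z ↦ by
    rcases eq_or_ne z 1 with rfl | hz
    · exact h1
    · rw [h0 z hz]; exact WithTop.zero_ne_top
  have hTE : characteristic (fun z ↦ Complex.exp (g z)) ⊤ =O[atTop] fun r : ℝ ↦ r ^ A := by
    rw [← funext hgE]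
    exact isBigO_characteristic_congr hEeq (isBigO_characteristic_mul hG hGtop hP
      (meromorphicOrderAt_sub_one_zpow_ne_top _) hT (isBigO_characteristic_sub_one_zpow hA _))
  have hav : (fun r ↦ Real.circleAverage (fun z ↦ |(g z).re|) 0 r) =O[atTop]
      fun r : ℝ ↦ r ^ A := by
    simp_rw [circleAverage_abs_re_eq hg]
    exact (hTE.const_mul_left 2).sub (isBigO_const_rpow (by linarith) _)
  obtain ⟨C, hC⟩ := hav.bound
  obtain ⟨p, hpdeg, hp⟩ := exists_polynomial_of_circleAverage_abs_re_le hg (A := A) (C := C)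
    (by linarith) (by
      filter_upwards [hC, eventually_ge_atTop 0] with r hr hr0
      refine (le_abs_self _).trans (hr.trans (le_of_eq ?_))
      rw [Real.norm_of_nonneg (by positivity)])
  refine ⟨m, p, hpdeg, ?_⟩
  have hne : ∀ᶠ z in codiscrete ℂ, z ≠ (1 : ℂ) :=
    (Set.finite_singleton (1 : ℂ)).compl_mem_codiscrete
  filter_upwards [hEeq, hne] with z hz hz1
  rw [← hp, ← hgE, ← hz, Pi.mul_apply]
  simp only [P]
  have : (z - 1) ^ m ≠ 0 := zpow_ne_zero _ (sub_ne_zero.2 hz1)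
  rw [zpow_neg]
  field_simp

/-! ### Lower bounds on sectors -/

/-- A lower bound on an arc gives a lower bound for the proximity function. -/
theorem le_proximity_of_arc {f : ℂ → ℂ} (hf : Meromorphic f) (hf0 : ∀ᶠ z in codiscrete ℂ, f z ≠ 0)
    {α β r B : ℝ} (hα : 0 ≤ α) (hαβ : α ≤ β) (hβ : β ≤ 2 * Real.pi) (hr : 0 < r)
    (h : ∀ θ ∈ Set.Icc α β, f (circleMap 0 r θ) ≠ 0 →
      B ≤ Real.posLog ‖f (circleMap 0 r θ)‖) :
    (β - α) / (2 * Real.pi) * B ≤ proximity f ⊤ r := by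
  classical
  -- The bound is not assumed at zeros of `f`: in the application `f` is an inverse, whose zeros
  -- include default values. Changing `f` there makes the bound hold on the whole arc without
  -- affecting the proximity function.
  set g : ℂ → ℂ := fun z ↦ if f z = 0 then (Real.exp |B| : ℂ) else f z
  have hfg : f =ᶠ[codiscrete ℂ] g := by
    filter_upwards [hf0] with z hz
    simp [g, hz]
  have hg : Meromorphic g := fun z ↦ (hf z).congr (eventually_nhdsNE_of_codiscrete hfg z)
  have hgB : ∀ θ ∈ Set.Icc α β, B ≤ Real.posLog ‖g (circleMap 0 r θ)‖ := by
    intro θ hθ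
    simp only [g]
    split_ifs with h0
    · rw [Complex.norm_real, Real.norm_of_nonneg (Real.exp_pos _).le, posLog_exp,
        max_eq_right (abs_nonneg B)]
      exact le_abs_self B
    · exact h θ hθ h0
  have hint : CircleIntegrable (fun z ↦ Real.posLog ‖g z‖) 0 r :=
    hg.meromorphicOn.circleIntegrable_posLog_norm
  rw [proximity_congr_codiscrete hfg hr.ne', proximity_top, Real.circleAverage_def, smul_eq_mul]
  have hi : IntervalIntegrable (fun θ ↦ Real.posLog ‖g (circleMap 0 r θ)‖) MeasureTheory.volume 0
    (2 * Real.pi) := hint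
  have hsub : Set.uIcc α β ⊆ Set.uIcc 0 (2 * Real.pi) := by
    rw [Set.uIcc_of_le hαβ, Set.uIcc_of_le (by linarith)]
    exact Set.Icc_subset_Icc hα hβ
  have h1 : ∫ θ in α..β, Real.posLog ‖g (circleMap 0 r θ)‖ ≤
      ∫ θ in 0..(2 * Real.pi), Real.posLog ‖g (circleMap 0 r θ)‖ :=
    intervalIntegral.integral_mono_interval hα hαβ hβ
      (.of_forall fun θ ↦ Real.posLog_nonneg) hi
  have h2 : (β - α) * B ≤ ∫ θ in α..β, Real.posLog ‖g (circleMap 0 r θ)‖ := by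
    have := intervalIntegral.integral_mono_on (f := fun _ ↦ B) hαβ (by simp) (hi.mono_set hsub) hgB
    simpa using this
  calc (β - α) / (2 * Real.pi) * B = (2 * Real.pi)⁻¹ * ((β - α) * B) := by ring
    _ ≤ _ := by
      have := Real.pi_pos
      gcongr
      exact h2.trans h1

/-- The leading term dominates: `p z = z ^ n * p.reverse (1 / z)`, and the second factor tends to
the leading coefficient. Positivity at the direction `θ₀` persists on a small arc by continuity, and
`r ^ n ≥ r` gives a linear bound. -/
theorem exists_arc_le_re_eval {p : ℂ[X]} (hp : 0 < p.natDegree) {θ₀ : ℝ} (h0 : 0 < θ₀)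
    (h1 : θ₀ < Real.pi / 2)
    (hpos : 0 < (p.leadingCoeff * Complex.exp (θ₀ * Complex.I) ^ p.natDegree).re) :
    ∃ α β δ : ℝ, 0 < α ∧ α < β ∧ β < Real.pi / 2 ∧ 0 < δ ∧
      ∀ᶠ r : ℝ in atTop, ∀ θ ∈ Set.Icc α β, δ * r ≤ (p.eval (circleMap 0 r θ)).re := by
  set n := p.natDegree
  set a := p.leadingCoeff
  set φ : ℝ → ℝ := fun θ ↦ (a * Complex.exp (θ * Complex.I) ^ n).re with hφ
  set δ := φ θ₀ / 2 with hδ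
  have hδ0 : 0 < δ := half_pos hpos
  have hcont : Continuous φ := by simp only [hφ]; fun_prop
  have hev : ∀ᶠ θ in 𝓝 θ₀, δ < φ θ ∧ 0 < θ ∧ θ < Real.pi / 2 :=
    ((hcont.tendsto θ₀).eventually_const_lt (half_lt_self hpos)).and
      ((eventually_gt_nhds h0).and (eventually_lt_nhds h1))
  obtain ⟨ε, hε, hball⟩ := Metric.eventually_nhds_iff.1 hev
  have hin : ∀ θ ∈ Set.Icc (θ₀ - ε / 2) (θ₀ + ε / 2), δ < φ θ ∧ 0 < θ ∧ θ < Real.pi / 2 := by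
    intro θ hθ
    refine hball ?_
    rw [Real.dist_eq]
    exact (abs_le.2 ⟨by linarith [hθ.1], by linarith [hθ.2]⟩ : |θ - θ₀| ≤ ε / 2).trans_lt
      (half_lt_self hε)
  refine ⟨θ₀ - ε / 2, θ₀ + ε / 2, δ / 2, (hin _ ⟨le_rfl, by linarith⟩).2.1, by linarith,
    (hin _ ⟨by linarith, le_rfl⟩).2.2, by positivity, ?_⟩
  have hrev : Tendsto (fun w : ℂ ↦ p.reverse.eval w) (𝓝 0) (𝓝 a) := by
    have := p.reverse.continuous.tendsto 0
    rwa [← Polynomial.coeff_zero_eq_eval_zero, Polynomial.coeff_zero_reverse] at this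
  obtain ⟨ρ, hρ, hrevball⟩ := Metric.tendsto_nhds_nhds.1 hrev (δ / 2) (by positivity)
  filter_upwards [eventually_ge_atTop 1, eventually_gt_atTop ρ⁻¹] with r hr1 hr2 θ hθ
  have hr0 : 0 < r := by linarith
  set z := circleMap 0 r θ with hz
  have hzn : ‖z‖ = r := by simp [hz, abs_of_pos hr0]
  have hz0 : z ≠ 0 := by rintro h; rw [h, norm_zero] at hzn; linarith
  have hw : dist (p.reverse.eval z⁻¹) a < δ / 2 := by
    refine hrevball ?_
    rw [dist_zero_right, norm_inv, hzn]
    exact inv_lt_of_inv_lt₀ hρ hr2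
  have hpz : p.eval z = p.reverse.eval z⁻¹ * z ^ n := by
    let _ : Invertible z := invertibleOfNonzero hz0
    have := Polynomial.eval₂_reverse_mul_pow (RingHom.id ℂ) z p
    rw [invOf_eq_inv] at this
    simpa [Polynomial.eval₂_id] using this.symm
  set e := Complex.exp (θ * Complex.I) ^ n with he
  have hen : ‖e‖ = 1 := by rw [he, norm_pow, Complex.norm_exp_ofReal_mul_I, one_pow]
  have hzn' : z ^ n = ((r ^ n : ℝ) : ℂ) * e := by
    rw [hz, circleMap, zero_add, mul_pow]; push_cast; rfl
  have hre : (p.eval z).re = r ^ n * (p.reverse.eval z⁻¹ * e).re := by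
    rw [hpz, hzn', mul_left_comm, Complex.re_ofReal_mul]
  have hclose : δ / 2 ≤ (p.reverse.eval z⁻¹ * e).re := by
    have h2 : |(p.reverse.eval z⁻¹ * e).re - (a * e).re| ≤ δ / 2 := by
      rw [← Complex.sub_re, ← sub_mul]
      refine (Complex.abs_re_le_norm _).trans ?_
      rw [norm_mul, hen, mul_one, ← dist_eq_norm]
      exact hw.le
    have h3 : δ < (a * e).re := (hin θ hθ).1
    linarith [(abs_le.1 h2).1]
  rw [hre, mul_comm]
  have : r ≤ r ^ n := le_self_pow₀ hr1 hp.ne'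
  gcongr

/-- On a suitable arc in the right half-plane, the real part of a nonconstant polynomial is large
of constant sign. -/
theorem exists_arc_le_re_eval_or {p : ℂ[X]} (hp : 0 < p.natDegree) :
    ∃ α β δ : ℝ, 0 < α ∧ α < β ∧ β < Real.pi / 2 ∧ 0 < δ ∧
      ((∀ᶠ r : ℝ in atTop, ∀ θ ∈ Set.Icc α β, δ * r ≤ (p.eval (circleMap 0 r θ)).re) ∨
      (∀ᶠ r : ℝ in atTop, ∀ θ ∈ Set.Icc α β, δ * r ≤ ((-p).eval (circleMap 0 r θ)).re)) := by
  have hpi := Real.pi_pos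
  set n := p.natDegree with hn
  have hn1 : (1 : ℝ) ≤ n := by exact_mod_cast hp
  have hn0 : (n : ℝ) ≠ 0 := by positivity
  have ha : p.leadingCoeff ≠ 0 := by
    rw [Ne, Polynomial.leadingCoeff_eq_zero]
    intro h
    rw [hn, h, Polynomial.natDegree_zero] at hp
    exact hp.false
  have main : ∃ θ : ℝ, 0 < θ ∧ θ < Real.pi / 2 ∧
      (p.leadingCoeff * Complex.exp (θ * Complex.I) ^ n).re ≠ 0 := by
    by_contra! hcon
    -- In the direction `t / n` the leading term has argument shifted by `t`. If its real part
    -- vanished for all `t` in `(0, π / 2)`, the values `π / 6` and `π / 3` would already force the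
    -- leading coefficient to be `0`.
    have hval : ∀ t : ℝ, 0 < t → t < Real.pi / 2 →
        p.leadingCoeff.re * Real.cos t - p.leadingCoeff.im * Real.sin t = 0 := by
      intro t ht0 ht1
      have h1 := hcon (t / n) (by positivity) ((div_le_self ht0.le hn1).trans_lt ht1)
      rw [← Complex.exp_nat_mul] at h1
      have h2 : (n : ℂ) * (((t / n : ℝ) : ℂ) * Complex.I) = t * Complex.I := by
        have : (n : ℂ) ≠ 0 := by exact_mod_cast hp.ne'
        push_cast
        field_simp
      rw [h2, Complex.mul_re, Complex.exp_ofReal_mul_I_re, Complex.exp_ofReal_mul_I_im] at h1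
      exact h1
    have h1 := hval (Real.pi / 6) (by positivity) (by linarith)
    have h2 := hval (Real.pi / 3) (by positivity) (by linarith)
    rw [Real.cos_pi_div_six, Real.sin_pi_div_six] at h1
    rw [Real.cos_pi_div_three, Real.sin_pi_div_three] at h2
    have h3 : Real.sqrt 3 * Real.sqrt 3 = 3 := Real.mul_self_sqrt (by norm_num)
    have him : p.leadingCoeff.im = p.leadingCoeff.re * Real.sqrt 3 := by linarith
    have hre : p.leadingCoeff.re = 0 := by
      rw [him] at h2
      have : p.leadingCoeff.re * (Real.sqrt 3 * Real.sqrt 3) = p.leadingCoeff.re := by linarith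
      rw [h3] at this
      linarith
    exact ha (Complex.ext hre (by rw [him, hre, zero_mul]; rfl))
  obtain ⟨θ, h0, h1, h2⟩ := main
  rcases h2.lt_or_gt with h | h
  · obtain ⟨α, β, δ, c1, c2, c3, c4, c5⟩ := exists_arc_le_re_eval (p := -p) (by simpa using hp) h0 h1
      (by rw [Polynomial.leadingCoeff_neg, Polynomial.natDegree_neg, neg_mul, Complex.neg_re]
          linarith)
    exact ⟨α, β, δ, c1, c2, c3, c4, Or.inr c5⟩
  · obtain ⟨α, β, δ, c1, c2, c3, c4, c5⟩ := exists_arc_le_re_eval hp h0 h1 h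
    exact ⟨α, β, δ, c1, c2, c3, c4, Or.inl c5⟩

theorem norm_circleMap_sub_one_bounds {r θ : ℝ} (hr : 2 ≤ r) :
    r - 1 ≤ ‖circleMap 0 r θ - 1‖ ∧ ‖circleMap 0 r θ - 1‖ ≤ 2 * r := by
  have hzn : ‖circleMap 0 r θ‖ = r := by simp [abs_of_nonneg (by linarith : 0 ≤ r)]
  constructor
  · have := norm_sub_norm_le (circleMap 0 r θ) 1
    rwa [hzn, norm_one] at this
  · have := norm_sub_le (circleMap 0 r θ) 1
    rw [hzn, norm_one] at this
    linarith

/-- The exponential is at least `exp (δ r)`, which beats the worst possible size `(2 r) ^ (-|m|)` of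
the power. -/
theorem eventually_two_le_norm_zpow_mul_exp {m : ℤ} {p : ℂ[X]} {α β δ : ℝ} (hδ : 0 < δ)
    (h : ∀ᶠ r : ℝ in atTop, ∀ θ ∈ Set.Icc α β, δ * r ≤ (p.eval (circleMap 0 r θ)).re) :
    ∀ᶠ r : ℝ in atTop, ∀ θ ∈ Set.Icc α β,
      2 ≤ ‖(circleMap 0 r θ - 1) ^ m * Complex.exp (p.eval (circleMap 0 r θ))‖ := by
  set N := m.natAbs
  have h1 := (isLittleO_pow_exp_pos_mul_atTop N hδ).def (show (0 : ℝ) < ((2 : ℝ) ^ N * 2)⁻¹ by positivity)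
  filter_upwards [h, h1, eventually_ge_atTop 2] with r hr hr1 hr2 θ hθ
  set x := ‖circleMap 0 r θ - 1‖
  obtain ⟨hx1, hx2⟩ : r - 1 ≤ x ∧ x ≤ 2 * r := norm_circleMap_sub_one_bounds hr2
  have hx0 : 1 ≤ x := by linarith
  have hm : ((2 * r) ^ N)⁻¹ ≤ x ^ m := by
    have h2 : (x ^ N)⁻¹ ≤ x ^ m := by
      rw [← zpow_natCast, ← zpow_neg]
      exact zpow_le_zpow_right₀ hx0 (by omega)
    refine le_trans ?_ h2
    gcongr
  rw [Real.norm_of_nonneg (by positivity), Real.norm_of_nonneg (by positivity)] at hr1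
  have h3 : 2 * (2 * r) ^ N ≤ Real.exp (δ * r) := by
    rw [le_inv_mul_iff₀ (by positivity)] at hr1
    calc 2 * (2 * r) ^ N = 2 ^ N * 2 * r ^ N := by rw [mul_pow]; ring
      _ ≤ _ := hr1
  rw [norm_mul, norm_zpow, Complex.norm_exp]
  calc (2 : ℝ) = ((2 * r) ^ N)⁻¹ * (2 * (2 * r) ^ N) := by
        have : (2 * r) ^ N ≠ 0 := by positivity
        field_simp
    _ ≤ x ^ m * Real.exp (p.eval (circleMap 0 r θ)).re := by
        gcongr
        exact h3.trans (Real.exp_le_exp.2 (hr θ hθ))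

theorem eventually_two_le_norm_zpow_mul {m : ℤ} (hm : 0 < m) {c : ℂ} (hc : c ≠ 0) :
    ∀ᶠ r : ℝ in atTop, ∀ θ : ℝ, 2 ≤ ‖(circleMap 0 r θ - 1) ^ m * c‖ := by
  have hc' : 0 < ‖c‖ := norm_pos_iff.2 hc
  filter_upwards [eventually_ge_atTop 2, eventually_ge_atTop (2 / ‖c‖ + 1)] with r hr hr2 θ
  obtain ⟨hx1, -⟩ := norm_circleMap_sub_one_bounds (θ := θ) hr
  rw [norm_mul, norm_zpow]
  have h1 : ‖circleMap 0 r θ - 1‖ ≤ ‖circleMap 0 r θ - 1‖ ^ m := by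
    have := zpow_le_zpow_right₀ (show 1 ≤ ‖circleMap 0 r θ - 1‖ by linarith) (show 1 ≤ m by omega)
    rwa [zpow_one] at this
  calc (2 : ℝ) = 2 / ‖c‖ * ‖c‖ := by field_simp
    _ ≤ _ := by gcongr; linarith

/-- The function `(z - 1) ^ m * exp (p z)` stays away from `1` on an arc in the right half-plane,
unless it is identically `1`. -/
theorem exists_arc_le_norm_one_sub (m : ℤ) (p : ℂ[X])
    (hne : ¬ ∀ z : ℂ, (z - 1) ^ m * Complex.exp (p.eval z) = 1) :
    ∃ α β η : ℝ, 0 < α ∧ α < β ∧ β < Real.pi / 2 ∧ 0 < η ∧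
      ∀ᶠ r : ℝ in atTop, ∀ θ ∈ Set.Icc α β,
        η ≤ ‖1 - (circleMap 0 r θ - 1) ^ m * Complex.exp (p.eval (circleMap 0 r θ))‖ := by
  have hpi := Real.pi_pos
  have large : ∀ w : ℂ, 2 ≤ ‖w‖ → 1 / 2 ≤ ‖1 - w‖ := fun w hw ↦ by
    have := norm_sub_norm_le w 1
    rw [norm_sub_rev, norm_one] at this
    linarith
  have small : ∀ w : ℂ, 2 ≤ ‖w⁻¹‖ → 1 / 2 ≤ ‖1 - w‖ := fun w hw ↦ by
    have h1 := norm_sub_norm_le 1 w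
    rw [norm_one] at h1
    rw [norm_inv] at hw
    have h2 : ‖w‖ ≤ 2⁻¹ := by
      rw [← inv_inv ‖w‖]
      exact inv_anti₀ two_pos hw
    linarith
  have hinv : ∀ z : ℂ, ((z - 1) ^ m * Complex.exp (p.eval z))⁻¹ =
      (z - 1) ^ (-m) * Complex.exp ((-p).eval z) := fun z ↦ by
    rw [mul_inv, zpow_neg, Polynomial.eval_neg, Complex.exp_neg]
  -- If `p` is not constant, or `m ≠ 0`, the function has modulus at least `2` or at most `1 / 2` on
  -- the arc. Otherwise it is a constant other than `1`.
  rcases Nat.eq_zero_or_pos p.natDegree with hdeg | hdeg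
  · obtain ⟨c, hc⟩ : ∃ c, p = Polynomial.C c := ⟨_, Polynomial.eq_C_of_natDegree_eq_zero hdeg⟩
    have hev : ∀ z, p.eval z = c := fun z ↦ by rw [hc, Polynomial.eval_C]
    rcases lt_trichotomy m 0 with hm | rfl | hm
    · refine ⟨Real.pi / 6, Real.pi / 3, 1 / 2, by positivity, by linarith, by linarith,
        by norm_num, ?_⟩
      filter_upwards [eventually_two_le_norm_zpow_mul (m := -m) (by omega)
        (Complex.exp_ne_zero (-c))] with r hr θ _
      refine small _ ?_
      rw [hinv, Polynomial.eval_neg, hev]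
      exact hr θ
    · refine ⟨Real.pi / 6, Real.pi / 3, ‖1 - Complex.exp c‖, by positivity, by linarith,
        by linarith, ?_, .of_forall fun r θ _ ↦ by rw [hev, zpow_zero, one_mul]⟩
      refine norm_pos_iff.2 (sub_ne_zero.2 fun h ↦ hne fun z ↦ ?_)
      rw [hev, zpow_zero, one_mul, ← h]
    · refine ⟨Real.pi / 6, Real.pi / 3, 1 / 2, by positivity, by linarith, by linarith,
        by norm_num, ?_⟩
      filter_upwards [eventually_two_le_norm_zpow_mul hm (Complex.exp_ne_zero c)] with r hr θ _
      refine large _ ?_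
      rw [hev]
      exact hr θ
  · obtain ⟨α, β, δ, h1, h2, h3, h4, h5 | h5⟩ := exists_arc_le_re_eval_or hdeg
    · refine ⟨α, β, 1 / 2, h1, h2, h3, by norm_num, ?_⟩
      filter_upwards [eventually_two_le_norm_zpow_mul_exp (m := m) h4 h5] with r hr θ hθ
      exact large _ (hr θ hθ)
    · refine ⟨α, β, 1 / 2, h1, h2, h3, by norm_num, ?_⟩
      filter_upwards [eventually_two_le_norm_zpow_mul_exp (m := -m) h4 h5] with r hr θ hθ
      refine small _ ?_
      rw [hinv]
      exact hr θ hθ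

/-- A meromorphic function that decays exponentially on an arc has characteristic growing at least
linearly. -/
theorem exists_mul_le_characteristic {f : ℂ → ℂ} (hf : Meromorphic f)
    (hf0 : ∀ᶠ z in codiscrete ℂ, f z ≠ 0) {α β K κ : ℝ} (hα : 0 < α) (hαβ : α < β)
    (hβ : β < Real.pi / 2) (hK : 0 < K) (hκ : 0 < κ)
    (h : ∀ᶠ r : ℝ in atTop, ∀ θ ∈ Set.Icc α β, ‖f (circleMap 0 r θ)‖ ≤ K * 2 ^ (-(κ * r))) :
    ∃ c : ℝ, 0 < c ∧ ∀ᶠ r : ℝ in atTop, c * r ≤ characteristic f ⊤ r := by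
  have hpi := Real.pi_pos
  have hlog2 : 0 < Real.log 2 := Real.log_pos one_lt_two
  set γ := (β - α) / (2 * Real.pi)
  have hγ : 0 < γ := div_pos (by linarith) (by linarith)
  obtain ⟨C, hC⟩ := (isBigO_characteristic_sub_characteristic_inv hf).bound
  set c := γ * (κ * Real.log 2) with hc
  have hc0 : 0 < c := by positivity
  refine ⟨c / 2, by positivity, ?_⟩
  filter_upwards [h, hC, eventually_ge_atTop 1,
    eventually_ge_atTop ((C + γ * Real.log K) / (c / 2))] with r hr hrC hr1 hr2
  -- Decay of `f` on the arc makes `log ‖f⁻¹‖` at least linear there. The first main theorem then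
  -- carries the lower bound from `f⁻¹` to `f`, up to the bounded error `C`.
  have hprox : γ * (κ * Real.log 2 * r - Real.log K) ≤ proximity f⁻¹ ⊤ r := by
    refine le_proximity_of_arc hf.inv (hf0.mono fun z hz ↦ inv_ne_zero hz) hα.le hαβ.le
      (by linarith) (by linarith) fun θ hθ hne ↦ ?_
    have hne' : f (circleMap 0 r θ) ≠ 0 := by simpa using hne
    have hpos : 0 < ‖f (circleMap 0 r θ)‖ := norm_pos_iff.2 hne'
    refine le_trans ?_ (le_max_right _ _)
    rw [Pi.inv_apply, norm_inv, Real.log_inv]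
    have h1 := Real.log_le_log hpos (hr θ hθ)
    rw [Real.log_mul hK.ne' (by positivity), Real.log_rpow two_pos] at h1
    linarith
  have hT : proximity f⁻¹ ⊤ r ≤ characteristic f⁻¹ ⊤ r := by
    rw [characteristic, Pi.add_apply]
    linarith [logCounting_nonneg (f := f⁻¹) (e := ⊤) hr1]
  simp only [Pi.sub_apply, Pi.one_apply, norm_one, mul_one, Real.norm_eq_abs] at hrC
  have h2 := (abs_le.1 hrC).1
  rw [div_le_iff₀ (by positivity)] at hr2
  have h3 : γ * (κ * Real.log 2 * r - Real.log K) = c * r - γ * Real.log K := by rw [hc]; ring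
  linarith

/-! ### `L`-functions as meromorphic functions -/

section Continuation

variable {L F : ℂ → ℂ} {k : ℕ}

theorem eventually_codiscrete_ne_one : ∀ᶠ z in codiscrete ℂ, z ≠ (1 : ℂ) :=
  (Set.finite_singleton (1 : ℂ)).compl_mem_codiscrete

theorem eq_zpow_mul_of_continuation (hLF : ∀ s : ℂ, s ≠ 1 → (s - 1) ^ k * L s = F s) :
    L =ᶠ[codiscrete ℂ] F * fun z ↦ (z - 1) ^ (-(k : ℤ)) := by
  filter_upwards [eventually_codiscrete_ne_one] with z hz
  have : (z - 1) ^ k ≠ 0 := pow_ne_zero _ (sub_ne_zero.2 hz)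
  rw [Pi.mul_apply, ← hLF z hz, zpow_neg, zpow_natCast]
  field_simp

theorem analyticAt_of_continuation (hF : Differentiable ℂ F)
    (hLF : ∀ s : ℂ, s ≠ 1 → (s - 1) ^ k * L s = F s) {z : ℂ} (hz : z ≠ 1) : AnalyticAt ℂ L z := by
  have h1 : AnalyticAt ℂ (fun w ↦ F w / (w - 1) ^ k) z :=
    (hF.analyticAt z).div (by fun_prop) (pow_ne_zero _ (sub_ne_zero.2 hz))
  refine h1.congr ?_
  filter_upwards [isOpen_ne.mem_nhds hz] with w hw
  rw [← hLF w hw, mul_div_cancel_left₀ _ (pow_ne_zero _ (sub_ne_zero.2 hw))]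

theorem meromorphic_of_continuation (hF : Differentiable ℂ F)
    (hLF : ∀ s : ℂ, s ≠ 1 → (s - 1) ^ k * L s = F s) : Meromorphic L := fun z ↦
  ((hF.analyticAt z).meromorphicAt.mul (meromorphic_sub_one_zpow _ z)).congr
    (eventually_nhdsNE_of_codiscrete (eq_zpow_mul_of_continuation hLF) z |>.mono fun _ h ↦ h.symm)

theorem isBigO_characteristic_of_continuation (hF : Differentiable ℂ F) (hF0 : F ≠ 0)
    (hLF : ∀ s : ℂ, s ≠ 1 → (s - 1) ^ k * L s = F s)
    (hgrowth : ∀ q : ℝ, 1 < q → ∃ C : ℝ, 0 ≤ C ∧ ∀ s : ℂ, ‖F s‖ ≤ Real.exp (C * (1 + ‖s‖) ^ q))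
    {q : ℝ} (hq : 1 < q) : characteristic L ⊤ =O[atTop] fun r : ℝ ↦ r ^ q := by
  obtain ⟨C, hC, hFC⟩ := hgrowth q hq
  have han : AnalyticOnNhd ℂ F Set.univ := Complex.analyticOnNhd_univ_iff_differentiable.2 hF
  have htop : ∀ z, meromorphicOrderAt F z ≠ ⊤ := by
    intro z h
    refine hF0 (han.eq_of_frequently_eq (analyticOnNhd_const (v := (0 : ℂ))) (z₀ := z) ?_)
    exact (meromorphicOrderAt_eq_top_iff.1 h).frequently
  refine isBigO_characteristic_congr (eq_zpow_mul_of_continuation hLF).symm ?_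
  exact isBigO_characteristic_mul (fun z ↦ (hF.analyticAt z).meromorphicAt) htop
    (meromorphic_sub_one_zpow _) (meromorphicOrderAt_sub_one_zpow_ne_top _)
    (isBigO_characteristic_of_norm_le_exp hF (by linarith) hC hFC)
    (isBigO_characteristic_sub_one_zpow hq.le _)

theorem ne_zero_of_tendsto_one {C₀ : ℝ} (hLF : ∀ s : ℂ, s ≠ 1 → (s - 1) ^ k * L s = F s)
    (hL : ∀ s : ℂ, 2 ≤ s.re → ‖L s - 1‖ ≤ C₀ * 2 ^ (-s.re)) : F ≠ 0 := by
  rintro rfl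
  have hzero : ∀ s : ℂ, s ≠ 1 → L s = 0 := fun s hs ↦ by
    simpa [sub_ne_zero.2 hs] using hLF s hs
  have hlim : Tendsto (fun x : ℝ ↦ C₀ * (2 : ℝ) ^ (-x)) atTop (𝓝 0) := by
    simpa using ((tendsto_rpow_atBot_of_base_gt_one 2 one_lt_two).comp
      tendsto_neg_atTop_atBot).const_mul C₀
  obtain ⟨x, hx1, hx2⟩ := ((hlim.eventually_lt_const one_pos).and (eventually_ge_atTop 2)).exists
  have h1 := hL x (by simpa using hx2)
  rw [hzero x (by norm_cast; linarith), zero_sub, norm_neg, norm_one, Complex.ofReal_re] at h1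
  linarith

/-- Two continuations that agree near a point agree everywhere. -/
theorem eq_of_frequently_eq_of_continuation {L' F' : ℂ → ℂ} {k' : ℕ} (hF : Differentiable ℂ F)
    (hLF : ∀ s : ℂ, s ≠ 1 → (s - 1) ^ k * L s = F s) (hF' : Differentiable ℂ F')
    (hLF' : ∀ s : ℂ, s ≠ 1 → (s - 1) ^ k' * L' s = F' s) {z : ℂ}
    (h : ∀ᶠ w in 𝓝[≠] z, L w = L' w) {s : ℂ} (hs : s ≠ 1) : L s = L' s := by
  -- Multiplying crosswise clears both possible poles, even if `k` and `k'` differ, and the identity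
  -- theorem for entire functions applies.
  have h1 : (fun w ↦ (w - 1) ^ k' * F w) = fun w ↦ (w - 1) ^ k * F' w := by
    refine AnalyticOnNhd.eq_of_frequently_eq (𝕜 := ℂ) (z₀ := z)
      (Complex.analyticOnNhd_univ_iff_differentiable.2 (by fun_prop))
      (Complex.analyticOnNhd_univ_iff_differentiable.2 (by fun_prop)) (Eventually.frequently ?_)
    filter_upwards [h, eventually_nhdsNE_of_codiscrete eventually_codiscrete_ne_one z] with w hw hw1
    rw [← hLF w hw1, ← hLF' w hw1, hw]
    ring
  have h2 := congrFun h1 s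
  simp only [← hLF s hs, ← hLF' s hs] at h2
  have hs0 : s - 1 ≠ 0 := sub_ne_zero.2 hs
  have h3 : ((s - 1) ^ k' * (s - 1) ^ k) * L s = ((s - 1) ^ k' * (s - 1) ^ k) * L' s := by
    linear_combination h2
  exact mul_left_cancel₀ (mul_ne_zero (pow_ne_zero _ hs0) (pow_ne_zero _ hs0)) h3

end Continuation

/-! ### Sharing zeros -/

theorem eventually_codiscrete_of_forall_nhdsNE {p : ℂ → Prop} (h : ∀ x, ∀ᶠ z in 𝓝[≠] x, p z) :
    ∀ᶠ z in codiscrete ℂ, p z := by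
  refine mem_codiscrete.2 fun x ↦ ?_
  rw [disjoint_principal_right, compl_compl]
  exact h x

theorem meromorphicOrderAt_eq_top_of_eq_top {f : ℂ → ℂ} (hf : Meromorphic f) {x : ℂ}
    (hx : meromorphicOrderAt f x = ⊤) (y : ℂ) : meromorphicOrderAt f y = ⊤ := by
  by_contra hy
  exact (meromorphicOn_univ.2 hf).meromorphicOrderAt_ne_top_of_isPreconnected isPreconnected_univ
    (Set.mem_univ y) (Set.mem_univ x) hy hx

theorem eventually_codiscrete_ne_zero {f : ℂ → ℂ} (hf : Meromorphic f)
    (hf0 : ∀ z, meromorphicOrderAt f z ≠ ⊤) : ∀ᶠ z in codiscrete ℂ, f z ≠ 0 :=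
  eventually_codiscrete_of_forall_nhdsNE fun x ↦
    (meromorphicOrderAt_ne_top_iff_eventually_ne_zero (hf x)).1 (hf0 x)

/-- A transcendental meromorphic function does not coincide with a constant. -/
theorem IsTranscendentalMeromorphic.meromorphicOrderAt_sub_const_ne_top {h : ℂ → ℂ}
    (hh : IsTranscendentalMeromorphic h) (c z : ℂ) :
    meromorphicOrderAt (fun s ↦ h s - c) z ≠ ⊤ := by
  intro htop
  have hm : Meromorphic fun s ↦ h s - c := fun z ↦ (hh.1 z).sub (MeromorphicAt.const c z)
  have hall : ∀ᶠ s in codiscrete ℂ, h s - c = 0 := eventually_codiscrete_of_forall_nhdsNE fun x ↦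
    meromorphicOrderAt_eq_top_iff.1 (meromorphicOrderAt_eq_top_of_eq_top hm htop x)
  refine hh.2 ⟨Polynomial.C c, 1, one_ne_zero, ?_⟩
  filter_upwards [hall] with s hs
  simpa using sub_eq_zero.1 hs

/-- Away from the poles of `L₁` and `L₂`, a shared zero divisor of `L₁ - h` and `L₂ - h` forces
equality of orders. -/
theorem SameZerosCM.meromorphicOrderAt_eq {h L₁ L₂ : ℂ → ℂ} {z : ℂ} (hh : MeromorphicAt h z)
    (hL₁ : AnalyticAt ℂ L₁ z) (hL₂ : AnalyticAt ℂ L₂ z)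
    (hz : SameZerosCM (fun s ↦ L₁ s - h s) (fun s ↦ L₂ s - h s)) :
    meromorphicOrderAt (fun s ↦ L₁ s - h s) z = meromorphicOrderAt (fun s ↦ L₂ s - h s) z := by
  have hsub : ∀ L : ℂ → ℂ, (fun s ↦ L s - h s) = L + (-h) := fun L ↦ by
    ext s; simp [sub_eq_add_neg]
  have hneg : meromorphicOrderAt (-h) z = meromorphicOrderAt h z := meromorphicOrderAt_neg.symm
  -- At a pole of `h` both differences inherit the order of `h`. Elsewhere both orders are
  -- nonnegative, so truncation at `0` loses nothing.
  rcases lt_or_ge (meromorphicOrderAt h z) 0 with hlt | hge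
  · have key : ∀ {L : ℂ → ℂ}, AnalyticAt ℂ L z →
        meromorphicOrderAt (fun s ↦ L s - h s) z = meromorphicOrderAt h z := fun {L} hL ↦ by
      rw [hsub, meromorphicOrderAt_add_eq_right_of_lt hL.meromorphicAt, hneg]
      rw [hneg]
      exact hlt.trans_le hL.meromorphicOrderAt_nonneg
    rw [key hL₁, key hL₂]
  · have key : ∀ {L : ℂ → ℂ}, AnalyticAt ℂ L z →
        0 ≤ meromorphicOrderAt (fun s ↦ L s - h s) z := fun {L} hL ↦ by
      rw [hsub]
      refine le_trans (le_min hL.meromorphicOrderAt_nonneg ?_)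
        (meromorphicOrderAt_add hL.meromorphicAt hh.neg)
      rwa [hneg]
    have := hz z
    rwa [max_eq_left (key hL₁), max_eq_left (key hL₂)] at this

/-- If the quotient `(L₁ - h) / (L₂ - h)` is a nontrivial `(z - 1) ^ m * exp (p z)`, then the
characteristic of `h` grows at least linearly. -/
theorem exists_mul_le_characteristic_of_eq {h L₁ L₂ : ℂ → ℂ} (hh : IsTranscendentalMeromorphic h)
    {C₁ C₂ : ℝ} (hC₁ : 0 ≤ C₁) (hC₂ : 0 ≤ C₂)
    (hL₁ : ∀ s : ℂ, 2 ≤ s.re → ‖L₁ s - 1‖ ≤ C₁ * 2 ^ (-s.re))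
    (hL₂ : ∀ s : ℂ, 2 ≤ s.re → ‖L₂ s - 1‖ ≤ C₂ * 2 ^ (-s.re)) {m : ℤ} {p : ℂ[X]}
    (hne : ¬ ∀ z : ℂ, (z - 1) ^ m * Complex.exp (p.eval z) = 1)
    (heq : h =ᶠ[codiscrete ℂ]
      fun z ↦ L₂ z + (L₁ z - L₂ z) * (1 - (z - 1) ^ m * Complex.exp (p.eval z))⁻¹) :
    ∃ c : ℝ, 0 < c ∧ ∀ᶠ r : ℝ in atTop, c * r ≤ characteristic h ⊤ r := by
  obtain ⟨α, β, η, hα, hαβ, hβ, hη, harc⟩ := exists_arc_le_norm_one_sub m p hne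
  set W : ℂ → ℂ := fun z ↦ (z - 1) ^ m * Complex.exp (p.eval z)
  set f : ℂ → ℂ := fun z ↦ (L₂ z - 1) + (L₁ z - L₂ z) * (1 - W z)⁻¹
  have hhf : (fun z ↦ h z - 1) =ᶠ[codiscrete ℂ] f := by
    filter_upwards [heq] with z hz
    simp only [f, hz, W]
    ring
  have hm : Meromorphic fun z ↦ h z - 1 := fun z ↦ (hh.1 z).sub (MeromorphicAt.const 1 z)
  have hfm : Meromorphic f := fun z ↦ (hm z).congr (eventually_nhdsNE_of_codiscrete hhf z)
  have hf0 : ∀ᶠ z in codiscrete ℂ, f z ≠ 0 := by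
    filter_upwards [hhf, eventually_codiscrete_ne_zero hm
      (hh.meromorphicOrderAt_sub_const_ne_top 1)] with z h1 h2
    rwa [← h1]
  have hpi := Real.pi_pos
  -- On the arc `Re z = r cos θ ≥ r cos β`, which turns decay in `Re z` into decay in `r`.
  set κ := Real.cos β with hκ
  have hκ0 : 0 < κ := Real.cos_pos_of_mem_Ioo ⟨by linarith, hβ⟩
  set K := C₂ + (C₁ + C₂) * η⁻¹ + 1 with hK
  have hK0 : 0 < K := by positivity
  obtain ⟨c, hc, hcf⟩ := exists_mul_le_characteristic hfm hf0 hα hαβ hβ hK0 hκ0 (by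
    filter_upwards [harc, eventually_ge_atTop (2 / κ), eventually_gt_atTop 0] with r hr hr2 hr0 θ hθ
    set z := circleMap 0 r θ with hz
    have hre : z.re = r * Real.cos θ := by simp [hz, circleMap, Complex.exp_ofReal_mul_I_re]
    have hcos : κ ≤ Real.cos θ :=
      Real.cos_le_cos_of_nonneg_of_le_pi (hα.le.trans hθ.1) (by linarith) hθ.2
    have hκr : κ * r ≤ z.re := by rw [hre, mul_comm]; gcongr
    have h2 : 2 ≤ z.re := by
      rw [div_le_iff₀ hκ0] at hr2
      linarith
    have hexp : (2 : ℝ) ^ (-z.re) ≤ 2 ^ (-(κ * r)) :=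
      Real.rpow_le_rpow_of_exponent_le one_le_two (by linarith)
    have b1 : ‖L₁ z - 1‖ ≤ C₁ * 2 ^ (-(κ * r)) := (hL₁ z h2).trans (by gcongr)
    have b2 : ‖L₂ z - 1‖ ≤ C₂ * 2 ^ (-(κ * r)) := (hL₂ z h2).trans (by gcongr)
    have b3 : ‖L₁ z - L₂ z‖ ≤ (C₁ + C₂) * 2 ^ (-(κ * r)) := by
      calc ‖L₁ z - L₂ z‖ = ‖(L₁ z - 1) - (L₂ z - 1)‖ := by ring_nf
        _ ≤ _ := (norm_sub_le _ _).trans (by linarith)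
    have b4 : ‖(1 - W z)⁻¹‖ ≤ η⁻¹ := by
      rw [norm_inv]
      exact inv_anti₀ hη (hr θ hθ)
    set X' := (2 : ℝ) ^ (-(κ * r))
    have hX : 0 < X' := by positivity
    calc ‖f z‖ ≤ ‖L₂ z - 1‖ + ‖L₁ z - L₂ z‖ * ‖(1 - W z)⁻¹‖ :=
          (norm_add_le _ _).trans (by rw [norm_mul])
      _ ≤ C₂ * X' + ((C₁ + C₂) * X') * η⁻¹ := by gcongr
      _ ≤ K * X' := by rw [hK]; nlinarith)
  refine ⟨c / 2, by positivity, ?_⟩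
  filter_upwards [hcf, eventually_ne_atTop 0,
    eventually_ge_atTop ((Real.posLog ‖(1 : ℂ)‖ + Real.log 2) / (c / 2))] with r h1 h2 h3
  have h4 := (abs_le.1 (abs_characteristic_sub_characteristic_shift_le (a₀ := (1 : ℂ)) (r := r)
    hh.1)).1
  have h5 : characteristic (fun z ↦ h z - 1) ⊤ r = characteristic f ⊤ r :=
    characteristic_congr_codiscrete hhf h2
  rw [div_le_iff₀ (by positivity)] at h3
  rw [h5] at h4
  linarith

/-! ### The main theorem -/

theorem exists_norm_eval_le (p : ℂ[X]) :
    ∃ C : ℝ, 0 ≤ C ∧ ∀ z, ‖p.eval z‖ ≤ C * (1 + ‖z‖) ^ p.natDegree := by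
  refine ⟨∑ i ∈ Finset.range (p.natDegree + 1), ‖p.coeff i‖, by positivity, fun z ↦ ?_⟩
  rw [eval_eq_sum_range, Finset.sum_mul]
  refine (norm_sum_le _ _).trans (Finset.sum_le_sum fun i hi ↦ ?_)
  rw [norm_mul, norm_pow]
  gcongr
  calc ‖z‖ ^ i ≤ (1 + ‖z‖) ^ i := by gcongr; linarith
    _ ≤ (1 + ‖z‖) ^ p.natDegree :=
      pow_le_pow_right₀ (by linarith [norm_nonneg z]) (Finset.mem_range_succ_iff.1 hi)

theorem meromorphic_zpow_mul_exp (m : ℤ) (p : ℂ[X]) :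
    Meromorphic fun z : ℂ ↦ (z - 1) ^ m * Complex.exp (p.eval z) := fun z ↦
  (meromorphic_sub_one_zpow m z).mul
    ((show Differentiable ℂ fun z ↦ Complex.exp (p.eval z) from
      p.differentiable.cexp).analyticAt z).meromorphicAt

theorem isBigO_characteristic_zpow_mul_exp (m : ℤ) (p : ℂ[X]) {q : ℝ} (hq : 1 ≤ q)
    (hp : (p.natDegree : ℝ) ≤ q) :
    characteristic (fun z : ℂ ↦ (z - 1) ^ m * Complex.exp (p.eval z)) ⊤ =O[atTop]
      fun r : ℝ ↦ r ^ q := by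
  have hd : Differentiable ℂ fun z ↦ Complex.exp (p.eval z) := p.differentiable.cexp
  obtain ⟨C, hC, hpC⟩ := exists_norm_eval_le p
  have hexp : characteristic (fun z ↦ Complex.exp (p.eval z)) ⊤ =O[atTop] fun r : ℝ ↦ r ^ q := by
    refine isBigO_characteristic_of_norm_le_exp hd (by linarith) hC fun z ↦ ?_
    rw [Complex.norm_exp]
    refine Real.exp_le_exp.2 ((Complex.re_le_norm _).trans ((hpC z).trans ?_))
    gcongr
    rw [← Real.rpow_natCast]
    exact Real.rpow_le_rpow_of_exponent_le (by linarith [norm_nonneg z]) hp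
  refine isBigO_characteristic_mul (meromorphic_sub_one_zpow m)
    (meromorphicOrderAt_sub_one_zpow_ne_top m) (fun z ↦ (hd.analyticAt z).meromorphicAt)
    (fun z ↦ ?_) (isBigO_characteristic_sub_one_zpow hq m) hexp
  rw [(hd.analyticAt z).meromorphicNFAt.meromorphicOrderAt_eq_zero_iff.2 (Complex.exp_ne_zero _)]
  exact WithTop.zero_ne_top

/-- Meromorphic functions with the same zeros counting multiplicities vanish identically together. -/
theorem SameZerosCM.eq_top_of_eq_top {f g : ℂ → ℂ} (h : SameZerosCM f g) {z : ℂ}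
    (hf : meromorphicOrderAt f z = ⊤) : meromorphicOrderAt g z = ⊤ := by
  have h1 := h z
  rw [hf, max_eq_left le_top] at h1
  rcases max_choice (meromorphicOrderAt g z) 0 with h2 | h2
  · rw [← h2, ← h1]
  · rw [h2] at h1
    exact absurd h1 WithTop.top_ne_zero

theorem meromorphicOrderAt_inv_ne_top {f : ℂ → ℂ} {z : ℂ} (hf : meromorphicOrderAt f z ≠ ⊤) :
    meromorphicOrderAt f⁻¹ z ≠ ⊤ := by
  rw [meromorphicOrderAt_inv]
  lift meromorphicOrderAt f z to ℤ using hf with n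
  exact WithTop.coe_ne_top

/-- Two `L`-functions that share the zeros of their differences with a transcendental meromorphic
function whose order is finite and not a positive integer coincide. -/
theorem IsLFunction.eq_of_sameZerosCM {h L₁ L₂ : ℂ → ℂ}
    (h_transcendental : IsTranscendentalMeromorphic h) (h_order_finite : nevanlinnaOrder h ≠ ⊤)
    (h_order_not_nat : ∀ n : ℕ, 1 ≤ n → nevanlinnaOrder h ≠ ((n : ℝ) : EReal))
    (hL₁ : IsLFunction L₁) (hL₂ : IsLFunction L₂)
    (h_zeros : SameZerosCM (fun s ↦ L₁ s - h s) (fun s ↦ L₂ s - h s)) :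
    ∀ s : ℂ, s ≠ 1 → L₁ s = L₂ s := by
  by_contra hcon
  obtain ⟨k₁, F₁, C₁, hF₁, hLF₁, hC₁, hLC₁, hg₁⟩ := hL₁.exists_growth
  obtain ⟨k₂, F₂, C₂, hF₂, hLF₂, hC₂, hLC₂, hg₂⟩ := hL₂.exists_growth
  have hloc : ∀ z, ¬ ∀ᶠ w in 𝓝[≠] z, L₁ w = L₂ w := fun z hz ↦
    hcon fun s hs ↦ eq_of_frequently_eq_of_continuation hF₁ hLF₁ hF₂ hLF₂ hz hs
  have hh := h_transcendental.1
  have hm₁ : Meromorphic L₁ := meromorphic_of_continuation hF₁ hLF₁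
  have hm₂ : Meromorphic L₂ := meromorphic_of_continuation hF₂ hLF₂
  have hf₁ : Meromorphic (L₁ - h) := hm₁.sub hh
  have hf₂ : Meromorphic (L₂ - h) := hm₂.sub hh
  have hnot : ∀ z, ¬ (meromorphicOrderAt (L₁ - h) z = ⊤ ∧ meromorphicOrderAt (L₂ - h) z = ⊤) := by
    rintro z ⟨h1, h2⟩
    refine hloc z ?_
    filter_upwards [meromorphicOrderAt_eq_top_iff.1 h1, meromorphicOrderAt_eq_top_iff.1 h2]
      with w hw1 hw2
    rw [Pi.sub_apply] at hw1 hw2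
    linear_combination hw1 - hw2
  -- If one difference vanished identically, the shared zeros would make the other vanish too,
  -- giving `L₁ = L₂ = h`.
  have hf₁0 : ∀ z, meromorphicOrderAt (L₁ - h) z ≠ ⊤ := fun z hz ↦
    hnot z ⟨hz, h_zeros.eq_top_of_eq_top hz⟩
  have hf₂0 : ∀ z, meromorphicOrderAt (L₂ - h) z ≠ ⊤ := fun z hz ↦
    hnot z ⟨SameZerosCM.eq_top_of_eq_top (fun w ↦ (h_zeros w).symm) hz, hz⟩
  have hG : Meromorphic ((L₁ - h) * (L₂ - h)⁻¹) := hf₁.mul hf₂.inv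
  have hG0 : ∀ z, z ≠ 1 → meromorphicOrderAt ((L₁ - h) * (L₂ - h)⁻¹) z = 0 := fun z hz ↦ by
    have h1 : meromorphicOrderAt (L₁ - h) z = meromorphicOrderAt (L₂ - h) z :=
      h_zeros.meromorphicOrderAt_eq (hh z) (analyticAt_of_continuation hF₁ hLF₁ hz)
        (analyticAt_of_continuation hF₂ hLF₂ hz)
    have h2 := hf₂0 z
    rw [meromorphicOrderAt_mul (hf₁ z) (hf₂ z).inv, meromorphicOrderAt_inv, h1]
    lift meromorphicOrderAt (L₂ - h) z to ℤ using h2 with n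
    norm_cast
    simp
  have hG1 : meromorphicOrderAt ((L₁ - h) * (L₂ - h)⁻¹) 1 ≠ ⊤ := by
    rw [meromorphicOrderAt_mul (hf₁ 1) (hf₂ 1).inv]
    exact WithTop.add_ne_top.2 ⟨hf₁0 1, meromorphicOrderAt_inv_ne_top (hf₂0 1)⟩
  have hT₁ : ∀ q : ℝ, 1 < q → characteristic L₁ ⊤ =O[atTop] fun r : ℝ ↦ r ^ q := fun q hq ↦
    isBigO_characteristic_of_continuation hF₁ (ne_zero_of_tendsto_one hLF₁ hLC₁) hLF₁ hg₁ hq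
  have hT₂ : ∀ q : ℝ, 1 < q → characteristic L₂ ⊤ =O[atTop] fun r : ℝ ↦ r ^ q := fun q hq ↦
    isBigO_characteristic_of_continuation hF₂ (ne_zero_of_tendsto_one hLF₂ hLC₂) hLF₂ hg₂ hq
  -- The factorisation is stated for every admissible `A`, since the two halves of the argument need
  -- different exponents.
  have hfactor : ∀ A : ℝ, 1 < A → nevanlinnaOrder h < A → ∃ (m : ℤ) (p : ℂ[X]),
      (p.natDegree : ℝ) ≤ A ∧ (∀ z, meromorphicOrderAt
        (fun z ↦ 1 - (z - 1) ^ m * Complex.exp (p.eval z)) z ≠ ⊤) ∧ h =ᶠ[codiscrete ℂ]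
        fun z ↦ L₂ z + (L₁ z - L₂ z) * (1 - (z - 1) ^ m * Complex.exp (p.eval z))⁻¹ := by
    intro A hA hhA
    have hA0 : 0 ≤ A := by linarith
    have hTh := isBigO_of_nevanlinnaOrder_lt hhA
    have hTG := isBigO_characteristic_mul hf₁ hf₁0 hf₂.inv
      (fun z ↦ meromorphicOrderAt_inv_ne_top (hf₂0 z))
      (isBigO_characteristic_sub hA0 hm₁ hh (hT₁ A hA) hTh)
      (isBigO_characteristic_inv hA0 hf₂ (isBigO_characteristic_sub hA0 hm₂ hh (hT₂ A hA) hTh))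
    obtain ⟨m, p, hp, hGW⟩ := exists_eq_zpow_mul_exp_of_isBigO hG hG0 hG1 hA.le hTG
    have hW : ∀ᶠ z in codiscrete ℂ,
        L₁ z - h z = (z - 1) ^ m * Complex.exp (p.eval z) * (L₂ z - h z) := by
      filter_upwards [hGW, eventually_codiscrete_ne_zero hf₂ hf₂0] with z hz hz0
      rw [← hz]
      simp only [Pi.mul_apply, Pi.inv_apply, Pi.sub_apply] at hz0 ⊢
      rw [inv_mul_cancel_right₀ hz0]
    have hW0 : ∀ z, meromorphicOrderAt
        (fun z ↦ 1 - (z - 1) ^ m * Complex.exp (p.eval z)) z ≠ ⊤ := by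
      intro z hz
      refine hloc z ?_
      filter_upwards [meromorphicOrderAt_eq_top_iff.1 hz, eventually_nhdsNE_of_codiscrete hW z]
        with w hw1 hw2
      linear_combination hw2 - (L₂ w - h w) * hw1
    refine ⟨m, p, hp, hW0, ?_⟩
    filter_upwards [hW, eventually_codiscrete_ne_zero
      (fun z ↦ (MeromorphicAt.const 1 z).sub (meromorphic_zpow_mul_exp m p z)) hW0] with z hz hz0
    change 1 - (z - 1) ^ m * Complex.exp (p.eval z) ≠ 0 at hz0
    rw [← sub_eq_iff_eq_add', eq_mul_inv_iff_mul_eq₀ hz0]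
    linear_combination -hz
  have hone : 1 ≤ nevanlinnaOrder h := by
    by_contra! hlt
    obtain ⟨m, p, -, hW0, heq⟩ := hfactor 2 one_lt_two
      (hlt.trans (by exact_mod_cast one_lt_two (α := ℝ)))
    obtain ⟨c, hc, hcT⟩ := exists_mul_le_characteristic_of_eq h_transcendental hC₁ hC₂ hLC₁ hLC₂
      (fun hall ↦ hW0 0 (meromorphicOrderAt_eq_top_iff.2 (.of_forall fun z ↦ by simp [hall z]))) heq
    exact (one_le_nevanlinnaOrder hc hcT).not_gt hlt
  obtain ⟨x, hx⟩ : ∃ x : ℝ, nevanlinnaOrder h = x :=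
    ⟨_, (EReal.coe_toReal h_order_finite (ne_bot_of_gt (EReal.bot_lt_coe 1 |>.trans_le hone))).symm⟩
  rw [hx] at hone
  have hx1 : 1 ≤ x := by exact_mod_cast hone
  have hn1 : 1 ≤ ⌊x⌋₊ := (Nat.one_le_floor_iff x).2 hx1
  have hnx : (⌊x⌋₊ : ℝ) < x := (Nat.floor_le (by linarith)).lt_of_ne fun hne ↦
    h_order_not_nat _ hn1 (by rw [hx, hne])
  have hxn : x < ⌊x⌋₊ + 1 := Nat.lt_floor_add_one x
  -- Keeping `A` below `⌊x⌋ + 1` makes the integer `deg p ≤ A` at most `⌊x⌋`.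
  obtain ⟨A, hxA, hAn⟩ := exists_between hxn
  obtain ⟨m, p, hp, hW0, heq⟩ := hfactor A (by linarith) (by rw [hx]; exact_mod_cast hxA)
  have hpn : p.natDegree ≤ ⌊x⌋₊ := Nat.lt_succ_iff.1 (by exact_mod_cast hp.trans_lt hAn)
  -- With `⌊x⌋ < q < x` and `⌊x⌋ ≥ 1`, the exponent `q` exceeds both `1`, as the `L`-functions
  -- require, and `deg p`. The intermediate `y` keeps the resulting order strictly below `x`.
  obtain ⟨q, hnq, hqx⟩ := exists_between hnx
  obtain ⟨y, hqy, hyx⟩ := exists_between hqx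
  have hn1' : (1 : ℝ) ≤ ⌊x⌋₊ := by exact_mod_cast hn1
  have hq1 : 1 < q := by linarith
  have hq0 : 0 ≤ q := by linarith
  have hpq : (p.natDegree : ℝ) ≤ q := le_trans (by exact_mod_cast hpn) hnq.le
  have hWm := meromorphic_zpow_mul_exp m p
  have h1W : Meromorphic fun z ↦ 1 - (z - 1) ^ m * Complex.exp (p.eval z) := fun z ↦
    (MeromorphicAt.const 1 z).sub (hWm z)
  have hTW : characteristic (fun z ↦ 1 - (z - 1) ^ m * Complex.exp (p.eval z)) ⊤ =O[atTop]
      fun r : ℝ ↦ r ^ q :=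
    isBigO_characteristic_sub hq0 (fun z ↦ MeromorphicAt.const 1 z) hWm
      (isBigO_characteristic_const hq0 1) (isBigO_characteristic_zpow_mul_exp m p hq1.le hpq)
  have hL0 : ∀ z, meromorphicOrderAt (L₁ - L₂) z ≠ ⊤ := fun z hz ↦ hloc z <| by
    filter_upwards [meromorphicOrderAt_eq_top_iff.1 hz] with w hw using sub_eq_zero.1 hw
  have hTh : characteristic h ⊤ =O[atTop] fun r : ℝ ↦ r ^ q :=
    isBigO_characteristic_congr heq.symm <|
      isBigO_characteristic_add hq0 hm₂ ((hm₁.sub hm₂).mul h1W.inv) (hT₂ q hq1) <|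
        isBigO_characteristic_mul (hm₁.sub hm₂) hL0 h1W.inv
          (fun z ↦ meromorphicOrderAt_inv_ne_top (hW0 z))
          (isBigO_characteristic_sub hq0 hm₁ hm₂ (hT₁ q hq1) (hT₂ q hq1))
          (isBigO_characteristic_inv hq0 h1W hTW)
  have hle := nevanlinnaOrder_le_of_isBigO hq0 hqy hTh
  rw [hx] at hle
  have : x ≤ y := by exact_mod_cast hle
  linarith

end MovingTarget

/-- The point `1` is left out because `IsLFunction` does not prescribe the value there. -/
theorem theorem4 (h L₁ L₂ : ℂ → ℂ)
    (h_transcendental : MovingTarget.IsTranscendentalMeromorphic h)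
    (h_pole : ∃ z : ℂ, meromorphicOrderAt h z < 0)
    (h_order_finite : MovingTarget.nevanlinnaOrder h ≠ ⊤)
    (h_order_not_nat : ∀ n : ℕ, 1 ≤ n → MovingTarget.nevanlinnaOrder h ≠ ((n : ℝ) : EReal))
    (hL₁ : MovingTarget.IsLFunction L₁) (hL₂ : MovingTarget.IsLFunction L₂)
    (hd₁ : ∃ d : ℝ, 0 < d ∧ MovingTarget.HasDegree L₁ d)
    (hd₂ : ∃ d : ℝ, 0 < d ∧ MovingTarget.HasDegree L₂ d)
    (h_zeros : MovingTarget.SameZerosCM (fun s => L₁ s - h s) (fun s => L₂ s - h s)) :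
    ∀ s : ℂ, s ≠ 1 → L₁ s = L₂ s := by
  exact hL₁.eq_of_sameZerosCM h_transcendental h_order_finite h_order_not_nat hL₂ h_zeros
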